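/- **Setting.** Let $\mathcal U\subset\mathbb R^4$ be open with coordinates $(x^1,x^2,x^3,x^4)=(\xi^1,\xi^2,\underline u,u)$. Let $\Phi=(e,\gamma,w):\mathcal U\to\mathcal R$, where $\mathcal R=\{(e,\gamma,w)\in\mathbb C^5\oplus\mathbb C^8\oplus\mathbb C^5 : e_3,e_4,e_5,\gamma_2,\gamma_6\in\mathbb R\}$, and let $\lambda_1,\lambda_2,\lambda_3,\lambda_4$ be strictly positive $C^1$ functions on $\mathcal U$. Put $$D=e_1\partial_{\xi^1}+e_2\partial_{\xi^2},\quad \overline D=\overline e_1\partial_{\xi^1}+\overline e_2\partial_{\xi^2},\quad N=e_4\partial_{\xi^1}+e_5\partial_{\xi^2}+\partial_u,\quad L=e_3\partial_{\underline u}.$$ **(SHS)** is the system $\mathbf A(\Phi)\Phi=\mathbf f(\Phi)$ with $\mathbf A=\mathbf A_1\oplus\mathbf A_2\oplus\mathbf A_3$, $\mathbf A_1=\mathrm{diag}(L,L,N,L,L)$, $\mathbf A_2=\mathrm{diag}(L,L,L,L,N,N,N,L)$, $$\mathbf A_3=\begin{pmatrix}\lambda_1N&\lambda_1D&0&0&0\\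 \lambda_1\overline D&\lambda_1L+\lambda_2N&\lambda_2D&0&0\\ 0&\lambda_2\overline D&\lambda_2L+\lambda_3N&\lambda_3D&0\\ 0&0&\lambda_3\overline D&\lambda_3L+\lambda_4N&\lambda_4D\\ 0&0&0&\lambda_4\overline D&\lambda_4L\end{pmatrix}$$ and right hand side $\mathbf f=(\mathbf f_{j1})\oplus(\mathbf f_{j2})\oplus(\mathbf f_{j3})$, $$\mathbf f_{j1}=\left\{\begin{aligned}&-e_1\gamma_2-\overline e_1\gamma_1\\&-e_2\gamma_2-\overline e_2\gamma_1\\&e_3\,2\,\Re\gamma_8\\&2\,\Re(-e_1\gamma_4+e_1\gamma_5+e_1\overline\gamma_3)\\&2\,\Re(-e_2\gamma_4+e_2\gamma_5+e_2\overline\gamma_3)\end{aligned}\right.$$ $$\mathbf f_{j2}=\left\{\begin{aligned}&-2\gamma_1\gamma_2-w_1\\&-|\gamma_1|^2-\gamma_2\gamma_2\\&\gamma_1\gamma_4-\gamma_1\gamma_5-\gamma_2\gamma_3-w_2\\&-\gamma_2\gamma_4+\gamma_2\gamma_5+\gamma_3\overline\gamma_1\\&-\gamma_3\gamma_7+\g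amma_4\gamma_6-\gamma_5\gamma_6-\gamma_5\gamma_8+\gamma_5\overline\gamma_8-\gamma_6\overline\gamma_3+\gamma_7\overline\gamma_4-\gamma_7\overline\gamma_5+w_4\\&-\gamma_6\gamma_6-\gamma_6\,2\,\Re\gamma_8-|\gamma_7|^2\\&-2\gamma_6\gamma_7-3\gamma_7\gamma_8+\gamma_7\overline\gamma_8-w_5\\&-2\gamma_3\gamma_4+2\gamma_3\gamma_5+\gamma_3\overline\gamma_3+\gamma_4\overline\gamma_4-\gamma_4\overline\gamma_5-\gamma_5\overline\gamma_4+w_3\end{aligned}\right.$$ $$\mathbf f_{j3}=\left\{\begin{aligned}&-\lambda_1(3\gamma_1w_3-6\gamma_3w_2+\gamma_6w_1-4\gamma_8w_1+4\overline\gamma_4w_2)\\&-\lambda_1(4\gamma_2w_2+4\gamma_4w_1+\gamma_5w_1)-\lambda_2(2\gamma_1w_4-3\gamma_3w_3+2\gamma_6w_2-2\gamma_8w_2+3\overline\gamma_4w_3)\\&-\lambda_2(3\gamma_2w_3+2\gamma_4w_2+2\gamma_5w_2+\gamma_7w_1)-\lambda_3(\gamma_1w_5+3\gamma_6w_3+2\overline\gamma_4w_4)\\&-\lambda_3(2\gamma_2w_4+3\gamma_5w_3+2\gamma_7w_2)-\lambda_4(3\gamma_3w_5+4\gamma_6w_4+2\gamma_8w_4+\overline\gamma_4w_5)\\&-\lambda_4(\gamma_2w_5-2\gamma_4w_4+4\gamma_5w_4+3\gamma_7w_3)\end{aligned}\right.$$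 **The constraint field** $\Phi^\sharp=(t,u,v)\in\mathbb C^5\oplus\mathbb C^9\oplus\mathbb C^3$ has the components $$t_j=\left\{\begin{aligned}&-2\,\Im\big(D(\overline e_1)+\overline e_1\gamma_3+\overline e_1\overline\gamma_4\big)\\&-2\,\Im\big(D(\overline e_2)+\overline e_2\gamma_3+\overline e_2\overline\gamma_4\big)\\&D(e_3)-e_3\gamma_3+e_3\overline\gamma_4+e_3\overline\gamma_5\\&\overline D(e_4)-N(\overline e_1)-e_1\gamma_7-\overline e_1\gamma_6+\overline e_1\overline\gamma_8-\overline e_1\gamma_8\\&\overline D(e_5)-N(\overline e_2)-e_2\gamma_7-\overline e_2\gamma_6+\overline e_2\overline\gamma_8-\overline e_2\gamma_8\end{aligned}\right.$$ $$u_j=\left\{\begin{aligned}&D(\gamma_2)-\overline D(\gamma_1)+w_2-3\gamma_1\gamma_4-\gamma_1\overline\gamma_3-\gamma_2\gamma_3+\gamma_2\overline\gamma_4\\&D(\gamma_4)+\overline D(\gamma_3)-w_3+2\gamma_3\gamma_4+\gamma_1\gamma_7-\gamma_2\gamma_6+\gamma_3\overline\gamma_3+\gamma_4\overline\gamma_4\\&\overline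 D(\gamma_3)-\overline D(\overline\gamma_4)+N(\gamma_2)-w_3+2\gamma_3\gamma_4-2\gamma_4\overline\gamma_4+\gamma_1\gamma_7+\gamma_2\gamma_6-\gamma_2\gamma_8-\gamma_2\overline\gamma_8\\&D(\overline\gamma_4)-D(\gamma_3)-N(\gamma_1)+3\gamma_1\gamma_8+2\gamma_3\gamma_3-2\gamma_3\overline\gamma_4-\gamma_1\gamma_6-\gamma_1\overline\gamma_8-\gamma_2\overline\gamma_7\\&\overline D(\gamma_5)-L(\gamma_7)-\gamma_2\gamma_7-\gamma_4\gamma_5+\gamma_5\gamma_5-\gamma_5\overline\gamma_3-\gamma_6\overline\gamma_1\\&L(\gamma_6)-D(\gamma_5)-w_3+\gamma_1\gamma_7+\gamma_2\gamma_6-\gamma_3\gamma_5-\gamma_5\overline\gamma_4-\gamma_5\overline\gamma_5\\&D(\gamma_8)-N(\gamma_3)-2\gamma_3\gamma_6+\gamma_3\gamma_8-\gamma_3\overline\gamma_8+\gamma_4\overline\gamma_7+\gamma_6\overline\gamma_4\\&N(\gamma_4)+\overline D(\gamma_8)+w_4-2\gamma_3\gamma_7+\gamma_4\gamma_6+\gamma_4\gamma_8-\gamma_4\overline\gamma_8+\gamma_7\overline\gamma_4\\&D(\gamma_7)-\overline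 D(\gamma_6)-w_4+3\gamma_3\gamma_7+\gamma_4\gamma_6-\gamma_6\overline\gamma_3+\gamma_7\overline\gamma_4\end{aligned}\right.$$ $$v_j=\left\{\begin{aligned}&\lambda_1\big(\overline D(w_1)+L(w_2)+4\gamma_2w_2+4\gamma_4w_1+\gamma_5w_1\big)\\&\lambda_2\big(\overline D(w_2)+L(w_3)+3\gamma_2w_3+2\gamma_4w_2+2\gamma_5w_2+\gamma_7w_1\big)\\&\lambda_3\big(\overline D(w_3)+L(w_4)+2\gamma_2w_4+3\gamma_5w_3+2\gamma_7w_2\big)\end{aligned}\right.$$ **The dual system** $\widehat{(\mathrm{SHS})}$ for a field $\psi=(t,u,v)$ is $\widehat{\mathbf A}(\Phi)\psi=\widehat{\mathbf f}(\Phi,\partial_x\Phi)\psi$ with $\widehat{\mathbf A}=\widehat{\mathbf A}_1\oplus\widehat{\mathbf A}_2\oplus\widehat{\mathbf A}_3$, $\widehat{\mathbf A}_1=\mathrm{diag}(L,L,N,L,L)$, $\widehat{\mathbf A}_2=\mathrm{diag}(L,L,L,L,N,N,L,L,N)$, $$\widehat{\mathbf A}_3=\begin{pmatrix}\frac1{\lambda_1}N+\frac1{\lambda_2}L&\frac1{\lambda_2}D&0\\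 \frac1{\lambda_2}\overline D&\frac1{\lambda_2}N+\frac1{\lambda_3}L&\frac1{\lambda_3}D\\ 0&\frac1{\lambda_3}\overline D&\frac1{\lambda_3}N+\frac1{\lambda_4}L\end{pmatrix}$$ and $\widehat{\mathbf f}\psi=(\widehat{\mathbf f}_{j1}\psi)\oplus(\widehat{\mathbf f}_{j2}\psi)\oplus(\widehat{\mathbf f}_{j3}\psi)$, where, writing $\partial_1,\partial_2,\partial_3$ for $\partial_{\xi^1},\partial_{\xi^2},\partial_{\underline u}$, $$\widehat{\mathbf f}_{j1}\psi=\left\{\begin{aligned}&-2\gamma_2t_1+2\,\Im(t_3\,\partial_3\overline e_1)+2\,\Im(\overline e_1u_1)\\&-2\gamma_2t_2+2\,\Im(t_3\,\partial_3\overline e_2)+2\,\Im(\overline e_2u_1)\\&(-\gamma_6+2\gamma_8)t_3-\overline\gamma_7\overline t_3-\overline t_4\,\partial_1e_3-\overline t_5\,\partial_2e_3+e_3u_7+e_3\overline u_8\\&i(\overline\gamma_3-\gamma_4+\gamma_5)t_1-\gamma_2t_4-\overline\gamma_1\overline t_4-\overline t_3\,\partial_3e_4+\overline e_1u_3-e_1\overline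 u_4+e_1u_5-\overline e_1\overline u_6\\&i(\overline\gamma_3-\gamma_4+\gamma_5)t_2-\gamma_2t_5-\overline\gamma_1\overline t_5-\overline t_3\,\partial_3e_5+\overline e_2u_3-e_2\overline u_4+e_2u_5-\overline e_2\overline u_6\end{aligned}\right.$$ $$\widehat{\mathbf f}_{j2}\psi=\left\{\begin{aligned}&-t_3\,\partial_3\gamma_2+\overline t_3\,\partial_3\gamma_1-3\gamma_2u_1+\gamma_1\overline u_1+\tfrac1{\lambda_1}v_1\\ &-t_3\,\partial_3\gamma_4-\overline t_3\,\partial_3\gamma_3-\gamma_4u_1+\gamma_5u_1-\gamma_3\overline u_1-2\gamma_2u_2-\gamma_1u_5-\gamma_2u_6-\tfrac1{\lambda_2}v_2\\ &-\overline t_3\,\partial_3\gamma_3+\overline t_3\,\partial_3\overline\gamma_4+\overline\gamma_3u_1-\gamma_4u_1+\gamma_5u_1-2\gamma_2u_3+\overline\gamma_1u_4+\gamma_1\overline u_4-\gamma_1u_5+\gamma_2\overline u_6-\tfrac1{\lambda_2}v_2\\ &t_3\,\partial_3\gamma_3-t_3\,\partial_3\overline\gamma_4+(\gamma_3-\overline\gamma_4+\overline\gamma_5)u_1+\gamma_1u_3+\gamma_1\overline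 u_3-2\gamma_2u_4+\gamma_2\overline u_5-\gamma_1u_6\\ &-t_4\,\partial_1\gamma_5-t_5\,\partial_2\gamma_5-\gamma_7u_3+\gamma_6\overline u_4-2\gamma_6u_5-2\gamma_8u_5+2\overline\gamma_8u_5\\&\qquad+\gamma_7u_6+\gamma_7\overline u_6+\gamma_5\overline u_7-\gamma_5u_8-\gamma_4u_9+\gamma_5u_9+\overline\gamma_3u_9\\ &\overline t_4\,\partial_1\gamma_5+\overline t_5\,\partial_2\gamma_5+\gamma_6\overline u_3-\gamma_7u_4+\overline\gamma_7u_5+\gamma_7\overline u_5-2\gamma_6u_6\\&\qquad+\gamma_5u_7-\gamma_5\overline u_8+\gamma_3u_9-\overline\gamma_4u_9+\overline\gamma_5u_9+\tfrac1{\lambda_3}v_2\\ &-t_3\,\partial_3\gamma_8-\gamma_3u_2+\overline\gamma_4u_2-\overline\gamma_5u_2+\gamma_3\overline u_3+\gamma_4u_4-\gamma_5u_4\\&\qquad-\gamma_4\overline u_5-2\gamma_3u_6+\overline\gamma_4u_6-\gamma_2u_7-\gamma_1u_8-\tfrac1{\lambda_2}v_1\\ &-\overline t_3\,\partial_3\gamma_8+\overline\gamma_3u_2-\gamma_4u_2+\gamma_5u_2-\gamma_4u_3+\gamma_5u_3-\gamma_3\overline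 u_4\\&\qquad+2\gamma_3u_5-\overline\gamma_4u_5+\gamma_4\overline u_6-\overline\gamma_1u_7-\gamma_2u_8+\tfrac1{\lambda_3}v_3\\ &t_4\,\partial_1\gamma_6-\overline t_4\,\partial_1\gamma_7+t_5\,\partial_2\gamma_6-\overline t_5\,\partial_2\gamma_7-3\gamma_7u_7+\gamma_6\overline u_7\\&\qquad+\gamma_6u_8+\gamma_7\overline u_8-3\gamma_6u_9-2\gamma_8u_9+\gamma_7\overline u_9+\tfrac1{\lambda_4}v_3\end{aligned}\right.$$ $$\begin{aligned}\widehat{\mathbf f}_{13}\psi=&-it_1\partial_1w_2-it_2\partial_2w_2+t_3\partial_3w_3-t_4\partial_1w_1-t_5\partial_2w_1+3w_3u_1+2w_2u_2+4w_2u_3-2w_2u_6+4w_1u_8+w_1u_9\\&+\big[-\tfrac4{\lambda_2}\gamma_2-\tfrac2{\lambda_1}\gamma_6+\tfrac3{\lambda_1}\gamma_8+\tfrac1{\lambda_1}\overline\gamma_8+\tfrac1{\lambda_1^2}N(\lambda_1)+\tfrac1{\lambda_2^2}L(\lambda_2)\big]v_1\\&+\big[\tfrac1{\lambda_2^2}D(\lambda_2)+\tfrac4{\lambda_2}\gamma_3-\tfrac4{\lambda_2}\overline\gamma_4-\tfrac1{\lambda_2}\overline\gamma_5\big]v_2-\tfrac2{\lambda_3}\gamma_1v_3\\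 \widehat{\mathbf f}_{23}\psi=&-it_1\partial_1w_3-it_2\partial_2w_3+t_3\partial_3w_4-t_4\partial_1w_2-t_5\partial_2w_2+2w_4u_1+3w_3u_3-3w_3u_6+2w_2u_8+2w_2u_9\\&+\big[-\tfrac2{\lambda_2}\gamma_4-\tfrac2{\lambda_2}\gamma_5+\tfrac1{\lambda_2^2}\overline D(\lambda_2)\big]v_1\\&+\big[-\tfrac3{\lambda_3}\gamma_2-\tfrac3{\lambda_2}\gamma_6+\tfrac1{\lambda_2}\gamma_8+\tfrac1{\lambda_2}\overline\gamma_8+\tfrac1{\lambda_2^2}N(\lambda_2)+\tfrac1{\lambda_3^2}L(\lambda_3)\big]v_2\\&+\big[\tfrac1{\lambda_3}\gamma_3-\tfrac3{\lambda_3}\overline\gamma_4-\tfrac1{\lambda_3}\overline\gamma_5+\tfrac1{\lambda_3^2}D(\lambda_3)\big]v_3\\ \widehat{\mathbf f}_{33}\psi=&-it_1\partial_1w_4-it_2\partial_2w_4+t_3\partial_3w_5-t_4\partial_1w_3-t_5\partial_2w_3+w_5u_1-2w_4u_2+2w_4u_3-4w_4u_6+3w_3u_9\\&-\tfrac2{\lambda_2}\gamma_7v_1+\big[-\tfrac3{\lambda_3}\gamma_5+\tfrac1{\lambda_3^2}\overline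 D(\lambda_3)\big]v_2\\&+\big[-\tfrac2{\lambda_4}\gamma_2-\tfrac4{\lambda_3}\gamma_6-\tfrac1{\lambda_3}\gamma_8+\tfrac1{\lambda_3}\overline\gamma_8+\tfrac1{\lambda_3^2}N(\lambda_3)+\tfrac1{\lambda_4^2}L(\lambda_4)\big]v_3\end{aligned}$$ Let $\widehat{\mathcal R}=\{(t,u,v)\in\mathbb C^5\oplus\mathbb C^9\oplus\mathbb C^3: t_1,t_2\in\mathbb R\}$. A classical solution of $\widehat{(\mathrm{SHS})}$ is a $C^1$ field $\psi:\mathcal U\to\widehat{\mathcal R}$ that satisfies the equation at every point of $\mathcal U$. **Proposition.** Suppose that $e_3>0$ on $\mathcal U$ and that $\Phi:\mathcal U\to\mathcal R$ is a $C^2$ solution of (SHS) on $\mathcal U$ with the weights $\lambda_1,\dots,\lambda_4$. Then: 1. The constraint field $\Phi^\sharp$ is a classical solution of $\widehat{(\mathrm{SHS})}$ on $\mathcal U$. 2. $\widehat{(\mathrm{SHS})}$ is a homogeneous, linear (over $\mathbb R$) symmetric hyperbolic system: at every point of $\mathcal U$ the map $\widehat{\mathbf f}(\Phi,\partial_x\Phi)$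 is $\mathbb R$-linear and maps $\widehat{\mathcal R}$ to itself, and, writing $\widehat{\mathbf A}=\widehat{\mathbf A}^\mu\partial_{x^\mu}$, all $\widehat{\mathbf A}^\mu$ are Hermitian and $\widehat{\mathbf A}^3+\widehat{\mathbf A}^4$ is positive definite (block by block). 3. In particular, if the data of $\Phi^\sharp$ for any well-posed problem for $\widehat{(\mathrm{SHS})}$ on $\mathcal U$ vanish, then $\Phi^\sharp=0$ everywhere on $\mathcal U$. Here a problem is given by a real linear space of admissible fields on $\mathcal U$ and a linear data map on it, and of well-posedness only uniqueness is needed: two admissible classical solutions of $\widehat{(\mathrm{SHS})}$ with the same data coincide on $\mathcal U$. -/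

import Mathlib

set_option linter.unusedVariables false

open scoped ComplexConjugate ComplexOrder Matrix ContDiff

noncomputable section

namespace DualSystem

/-- Points of `ℝ⁴`; the coordinates `(x¹, x², x³, x⁴)` have the indices `0, 1, 2, 3`. -/
abbrev Point := Fin 4 → ℝ

/-- The ambient space `ℂ⁵ ⊕ ℂ⁸ ⊕ ℂ⁵` of the triples `(e, γ, w)`. -/
abbrev StateVec := (Fin 5 → ℂ) × (Fin 8 → ℂ) × (Fin 5 → ℂ)

/-- The ambient space `ℂ⁵ ⊕ ℂ⁹ ⊕ ℂ³` of the triples `(t, u, v)`. -/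
abbrev ConstraintVec := (Fin 5 → ℂ) × (Fin 9 → ℂ) × (Fin 3 → ℂ)

/-- The real vector space `𝓡 = {(e, γ, w) | e₃, e₄, e₅, γ₂, γ₆ ∈ ℝ}`. -/
def stateSpace : Submodule ℝ StateVec where
  carrier := {p | (p.1 2).im = 0 ∧ (p.1 3).im = 0 ∧ (p.1 4).im = 0 ∧
    (p.2.1 1).im = 0 ∧ (p.2.1 5).im = 0}
  add_mem' := by
    rintro a b ⟨h1, h2, h3, h4, h5⟩ ⟨k1, k2, k3, k4, k5⟩
    simp [h1, h2, h3, h4, h5, k1, k2, k3, k4, k5]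
  zero_mem' := by simp
  smul_mem' := by
    rintro c a ⟨h1, h2, h3, h4, h5⟩
    simp [h1, h2, h3, h4, h5]

/-- The real vector space `𝓡^ = {(t, u, v) | t₁, t₂ ∈ ℝ}`. -/
def constraintSpace : Submodule ℝ ConstraintVec where
  carrier := {p | (p.1 0).im = 0 ∧ (p.1 1).im = 0}
  add_mem' := by
    rintro a b ⟨h1, h2⟩ ⟨k1, k2⟩
    simp [h1, h2, k1, k2]
  zero_mem' := by simp
  smul_mem' := by
    rintro c a ⟨h1, h2⟩
    simp [h1, h2]

/-- Fields `Φ = (e, γ, w)`; the condition that the values lie in `stateSpace` is imposed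
separately, on the domain under consideration. -/
abbrev StateField := Point → StateVec

/-! The eighteen components of a field, with the customary one-based names. -/

def StateField.e₁ (Φ : StateField) : Point → ℂ := fun y => (Φ y).1 0
def StateField.e₂ (Φ : StateField) : Point → ℂ := fun y => (Φ y).1 1
def StateField.e₃ (Φ : StateField) : Point → ℂ := fun y => (Φ y).1 2
def StateField.e₄ (Φ : StateField) : Point → ℂ := fun y => (Φ y).1 3
def StateField.e₅ (Φ : StateField) : Point → ℂ := fun y => (Φ y).1 4
def StateField.γ₁ (Φ : StateField) : Point → ℂ := fun y => (Φ y).2.1 0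
def StateField.γ₂ (Φ : StateField) : Point → ℂ := fun y => (Φ y).2.1 1
def StateField.γ₃ (Φ : StateField) : Point → ℂ := fun y => (Φ y).2.1 2
def StateField.γ₄ (Φ : StateField) : Point → ℂ := fun y => (Φ y).2.1 3
def StateField.γ₅ (Φ : StateField) : Point → ℂ := fun y => (Φ y).2.1 4
def StateField.γ₆ (Φ : StateField) : Point → ℂ := fun y => (Φ y).2.1 5
def StateField.γ₇ (Φ : StateField) : Point → ℂ := fun y => (Φ y).2.1 6
def StateField.γ₈ (Φ : StateField) : Point → ℂ := fun y => (Φ y).2.1 7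
def StateField.w₁ (Φ : StateField) : Point → ℂ := fun y => (Φ y).2.2 0
def StateField.w₂ (Φ : StateField) : Point → ℂ := fun y => (Φ y).2.2 1
def StateField.w₃ (Φ : StateField) : Point → ℂ := fun y => (Φ y).2.2 2
def StateField.w₄ (Φ : StateField) : Point → ℂ := fun y => (Φ y).2.2 3
def StateField.w₅ (Φ : StateField) : Point → ℂ := fun y => (Φ y).2.2 4

/-- Pointwise complex conjugate of a function. -/
def conjFun (f : Point → ℂ) : Point → ℂ := fun y => conj (f y)

/-- A weight function, regarded as complex valued. -/
def weightC (lam : Fin 4 → Point → ℝ) (i : Fin 4) : Point → ℂ := fun y => (lam i y : ℂ)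

/-- The coordinate derivative `∂f / ∂x^μ`. -/
def partialDeriv (μ : Fin 4) (f : Point → ℂ) (x : Point) : ℂ :=
  fderiv ℝ f x (Pi.single μ 1)

/-- The components `F_a^μ` of the complex frame `(F₁, F₂, F₃, F₄) = (D, D̄, N, L)`:
`D = e₁ ∂₁ + e₂ ∂₂`, `N = e₄ ∂₁ + e₅ ∂₂ + ∂₄`, `L = e₃ ∂₃`. -/
def frame (p : StateVec) : Matrix (Fin 4) (Fin 4) ℂ :=
  !![p.1 0, p.1 1, 0, 0;
     conj (p.1 0), conj (p.1 1), 0, 0;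
     p.1 3, p.1 4, 0, 1;
     0, 0, p.1 2, 0]

/-- The derivative of `f` along the frame vector field `F_a` determined by `Φ`. -/
def frameDeriv (a : Fin 4) (Φ : StateField) (f : Point → ℂ) (x : Point) : ℂ :=
  ∑ μ, frame (Φ x) a μ * partialDeriv μ f x

/-- The first order operator `∑ μ, A^μ ∂/∂x^μ` (coefficients frozen at `x`) applied to `ψ`
at the point `x`. -/
def matrixOp {n : Type} [Fintype n] (A : Fin 4 → Matrix n n ℂ) (ψ : Point → n → ℂ)
    (x : Point) : n → ℂ :=
  ∑ μ, A μ *ᵥ fun j => partialDeriv μ (fun y => ψ y j) x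

/-- Symmetric hyperbolicity of `∑ μ, A^μ ∂/∂x^μ` at a point, in the Hermitian form: all the
`A^μ` are Hermitian, and `A³ + A⁴` (indices `2` and `3` here) is positive definite. -/
def IsSymmetricHyperbolic {n : Type} [Fintype n] (A : Fin 4 → Matrix n n ℂ) : Prop :=
  (∀ μ, (A μ).IsHermitian) ∧ (A 2 + A 3).PosDef

/-! ### The quasilinear system for `Φ` -/

/-- Coefficients of `A₁ = diag(L, L, N, L, L)`. -/
def coeffA₁ (p : StateVec) (μ : Fin 4) : Matrix (Fin 5) (Fin 5) ℂ :=
  let N := frame p 2 μ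
  let L := frame p 3 μ
  Matrix.diagonal ![L, L, N, L, L]

/-- Coefficients of `A₂ = diag(L, L, L, L, N, N, N, L)`. -/
def coeffA₂ (p : StateVec) (μ : Fin 4) : Matrix (Fin 8) (Fin 8) ℂ :=
  let N := frame p 2 μ
  let L := frame p 3 μ
  Matrix.diagonal ![L, L, L, L, N, N, N, L]

/-- Coefficients of `A₃`, with the weights `l`. -/
def coeffA₃ (l : Fin 4 → ℝ) (p : StateVec) (μ : Fin 4) : Matrix (Fin 5) (Fin 5) ℂ :=
  let D := frame p 0 μ
  let Db := frame p 1 μ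
  let N := frame p 2 μ
  let L := frame p 3 μ
  let ℓ₁ := (l 0 : ℂ); let ℓ₂ := (l 1 : ℂ); let ℓ₃ := (l 2 : ℂ); let ℓ₄ := (l 3 : ℂ)
  !![ℓ₁ * N, ℓ₁ * D, 0, 0, 0;
     ℓ₁ * Db, ℓ₁ * L + ℓ₂ * N, ℓ₂ * D, 0, 0;
     0, ℓ₂ * Db, ℓ₂ * L + ℓ₃ * N, ℓ₃ * D, 0;
     0, 0, ℓ₃ * Db, ℓ₃ * L + ℓ₄ * N, ℓ₄ * D;
     0, 0, 0, ℓ₄ * Db, ℓ₄ * L]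

/-- The left hand side `A(Φ) Φ` at the point `x`. -/
def shsLHS (lam : Fin 4 → Point → ℝ) (Φ : StateField) (x : Point) : StateVec :=
  (matrixOp (coeffA₁ (Φ x)) (fun y => (Φ y).1) x,
   matrixOp (coeffA₂ (Φ x)) (fun y => (Φ y).2.1) x,
   matrixOp (coeffA₃ (fun i => lam i x) (Φ x)) (fun y => (Φ y).2.2) x)

/-- The quadratic right hand side `f(Φ)`, as a function of the value `p` of `Φ` and of the
values `l` of the weights. -/
def shsRHS (l : Fin 4 → ℝ) (p : StateVec) : StateVec :=
  let e₁ := p.1 0; let e₂ := p.1 1; let e₃ := p.1 2; let e₄ := p.1 3; let e₅ := p.1 4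
  let γ₁ := p.2.1 0; let γ₂ := p.2.1 1; let γ₃ := p.2.1 2; let γ₄ := p.2.1 3; let γ₅ := p.2.1 4
  let γ₆ := p.2.1 5; let γ₇ := p.2.1 6; let γ₈ := p.2.1 7
  let w₁ := p.2.2 0; let w₂ := p.2.2 1; let w₃ := p.2.2 2; let w₄ := p.2.2 3; let w₅ := p.2.2 4
  let ℓ₁ := (l 0 : ℂ); let ℓ₂ := (l 1 : ℂ); let ℓ₃ := (l 2 : ℂ); let ℓ₄ := (l 3 : ℂ)
  (![-e₁ * γ₂ - conj e₁ * γ₁,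
     -e₂ * γ₂ - conj e₂ * γ₁,
     e₃ * (2 * (γ₈).re : ℝ),
     (2 * (-e₁ * γ₄ + e₁ * γ₅ + e₁ * conj γ₃).re : ℝ),
     (2 * (-e₂ * γ₄ + e₂ * γ₅ + e₂ * conj γ₃).re : ℝ)],
   ![-2 * γ₁ * γ₂ - w₁,
     -(‖γ₁‖ ^ 2 : ℝ) - γ₂ * γ₂,
     γ₁ * γ₄ - γ₁ * γ₅ - γ₂ * γ₃ - w₂,
     -γ₂ * γ₄ + γ₂ * γ₅ + γ₃ * conj γ₁,
     -γ₃ * γ₇ + γ₄ * γ₆ - γ₅ * γ₆ - γ₅ * γ₈ + γ₅ * conj γ₈ - γ₆ * conj γ₃ + γ₇ * conj γ₄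
       - γ₇ * conj γ₅ + w₄,
     -γ₆ * γ₆ - γ₆ * (2 * (γ₈).re : ℝ) - (‖γ₇‖ ^ 2 : ℝ),
     -2 * γ₆ * γ₇ - 3 * γ₇ * γ₈ + γ₇ * conj γ₈ - w₅,
     -2 * γ₃ * γ₄ + 2 * γ₃ * γ₅ + γ₃ * conj γ₃ + γ₄ * conj γ₄ - γ₄ * conj γ₅ - γ₅ * conj γ₄
       + w₃],
   ![-ℓ₁ * (3 * γ₁ * w₃ - 6 * γ₃ * w₂ + γ₆ * w₁ - 4 * γ₈ * w₁ + 4 * conj γ₄ * w₂),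
     -ℓ₁ * (4 * γ₂ * w₂ + 4 * γ₄ * w₁ + γ₅ * w₁)
       - ℓ₂ * (2 * γ₁ * w₄ - 3 * γ₃ * w₃ + 2 * γ₆ * w₂ - 2 * γ₈ * w₂ + 3 * conj γ₄ * w₃),
     -ℓ₂ * (3 * γ₂ * w₃ + 2 * γ₄ * w₂ + 2 * γ₅ * w₂ + γ₇ * w₁)
       - ℓ₃ * (γ₁ * w₅ + 3 * γ₆ * w₃ + 2 * conj γ₄ * w₄),
     -ℓ₃ * (2 * γ₂ * w₄ + 3 * γ₅ * w₃ + 2 * γ₇ * w₂)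
       - ℓ₄ * (3 * γ₃ * w₅ + 4 * γ₆ * w₄ + 2 * γ₈ * w₄ + conj γ₄ * w₅),
     -ℓ₄ * (γ₂ * w₅ - 2 * γ₄ * w₄ + 4 * γ₅ * w₄ + 3 * γ₇ * w₃)])

/-- The quasilinear symmetric hyperbolic system `A(Φ) Φ = f(Φ)` on `U`. -/
def SolvesSHS (U : Set Point) (lam : Fin 4 → Point → ℝ) (Φ : StateField) : Prop :=
  ∀ x ∈ U, shsLHS lam Φ x = shsRHS (fun i => lam i x) (Φ x)

/-! ### The constraint field -/

/-- The constraint field `Φ♯ = (t, u, v)` associated to `Φ` and to the weights. -/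
def constraintField (lam : Fin 4 → Point → ℝ) (Φ : StateField) (x : Point) : ConstraintVec :=
  let e₁ := Φ.e₁ x; let e₂ := Φ.e₂ x; let e₃ := Φ.e₃ x; let e₄ := Φ.e₄ x; let e₅ := Φ.e₅ x
  let γ₁ := Φ.γ₁ x; let γ₂ := Φ.γ₂ x; let γ₃ := Φ.γ₃ x; let γ₄ := Φ.γ₄ x; let γ₅ := Φ.γ₅ x
  let γ₆ := Φ.γ₆ x; let γ₇ := Φ.γ₇ x; let γ₈ := Φ.γ₈ x
  let w₁ := Φ.w₁ x; let w₂ := Φ.w₂ x; let w₃ := Φ.w₃ x; let w₄ := Φ.w₄ x; let w₅ := Φ.w₅ x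
  let ℓ₁ := (lam 0 x : ℂ); let ℓ₂ := (lam 1 x : ℂ); let ℓ₃ := (lam 2 x : ℂ)
  let ℓ₄ := (lam 3 x : ℂ)
  let D : (Point → ℂ) → ℂ := fun f => frameDeriv 0 Φ f x
  let Db : (Point → ℂ) → ℂ := fun f => frameDeriv 1 Φ f x
  let N : (Point → ℂ) → ℂ := fun f => frameDeriv 2 Φ f x
  let L : (Point → ℂ) → ℂ := fun f => frameDeriv 3 Φ f x
  (![-(2 * (D (conjFun Φ.e₁) + conj e₁ * γ₃ + conj e₁ * conj γ₄).im : ℝ),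
     -(2 * (D (conjFun Φ.e₂) + conj e₂ * γ₃ + conj e₂ * conj γ₄).im : ℝ),
     D Φ.e₃ - e₃ * γ₃ + e₃ * conj γ₄ + e₃ * conj γ₅,
     Db Φ.e₄ - N (conjFun Φ.e₁) - e₁ * γ₇ - conj e₁ * γ₆ + conj e₁ * conj γ₈ - conj e₁ * γ₈,
     Db Φ.e₅ - N (conjFun Φ.e₂) - e₂ * γ₇ - conj e₂ * γ₆ + conj e₂ * conj γ₈ - conj e₂ * γ₈],
   ![D Φ.γ₂ - Db Φ.γ₁ + w₂ - 3 * γ₁ * γ₄ - γ₁ * conj γ₃ - γ₂ * γ₃ + γ₂ * conj γ₄,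
     D Φ.γ₄ + Db Φ.γ₃ - w₃ + 2 * γ₃ * γ₄ + γ₁ * γ₇ - γ₂ * γ₆ + γ₃ * conj γ₃ + γ₄ * conj γ₄,
     Db Φ.γ₃ - Db (conjFun Φ.γ₄) + N Φ.γ₂ - w₃ + 2 * γ₃ * γ₄ - 2 * γ₄ * conj γ₄ + γ₁ * γ₇
       + γ₂ * γ₆ - γ₂ * γ₈ - γ₂ * conj γ₈,
     D (conjFun Φ.γ₄) - D Φ.γ₃ - N Φ.γ₁ + 3 * γ₁ * γ₈ + 2 * γ₃ * γ₃ - 2 * γ₃ * conj γ₄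
       - γ₁ * γ₆ - γ₁ * conj γ₈ - γ₂ * conj γ₇,
     Db Φ.γ₅ - L Φ.γ₇ - γ₂ * γ₇ - γ₄ * γ₅ + γ₅ * γ₅ - γ₅ * conj γ₃ - γ₆ * conj γ₁,
     L Φ.γ₆ - D Φ.γ₅ - w₃ + γ₁ * γ₇ + γ₂ * γ₆ - γ₃ * γ₅ - γ₅ * conj γ₄ - γ₅ * conj γ₅,
     D Φ.γ₈ - N Φ.γ₃ - 2 * γ₃ * γ₆ + γ₃ * γ₈ - γ₃ * conj γ₈ + γ₄ * conj γ₇ + γ₆ * conj γ₄,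
     N Φ.γ₄ + Db Φ.γ₈ + w₄ - 2 * γ₃ * γ₇ + γ₄ * γ₆ + γ₄ * γ₈ - γ₄ * conj γ₈ + γ₇ * conj γ₄,
     D Φ.γ₇ - Db Φ.γ₆ - w₄ + 3 * γ₃ * γ₇ + γ₄ * γ₆ - γ₆ * conj γ₃ + γ₇ * conj γ₄],
   ![ℓ₁ * (Db Φ.w₁ + L Φ.w₂ + 4 * γ₂ * w₂ + 4 * γ₄ * w₁ + γ₅ * w₁),
     ℓ₂ * (Db Φ.w₂ + L Φ.w₃ + 3 * γ₂ * w₃ + 2 * γ₄ * w₂ + 2 * γ₅ * w₂ + γ₇ * w₁),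
     ℓ₃ * (Db Φ.w₃ + L Φ.w₄ + 2 * γ₂ * w₄ + 3 * γ₅ * w₃ + 2 * γ₇ * w₂)])

/-! ### The dual system for `Φ♯` -/

/-- Coefficients of `Â₁ = diag(L, L, N, L, L)`. -/
def coeffHat₁ (p : StateVec) (μ : Fin 4) : Matrix (Fin 5) (Fin 5) ℂ :=
  let N := frame p 2 μ
  let L := frame p 3 μ
  Matrix.diagonal ![L, L, N, L, L]

/-- Coefficients of `Â₂ = diag(L, L, L, L, N, N, L, L, N)`. -/
def coeffHat₂ (p : StateVec) (μ : Fin 4) : Matrix (Fin 9) (Fin 9) ℂ :=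
  let N := frame p 2 μ
  let L := frame p 3 μ
  Matrix.diagonal ![L, L, L, L, N, N, L, L, N]

/-- Coefficients of `Â₃`, with the weights `l`. -/
def coeffHat₃ (l : Fin 4 → ℝ) (p : StateVec) (μ : Fin 4) : Matrix (Fin 3) (Fin 3) ℂ :=
  let D := frame p 0 μ
  let Db := frame p 1 μ
  let N := frame p 2 μ
  let L := frame p 3 μ
  let ℓ₁ := (l 0 : ℂ); let ℓ₂ := (l 1 : ℂ); let ℓ₃ := (l 2 : ℂ); let ℓ₄ := (l 3 : ℂ)
  !![1 / ℓ₁ * N + 1 / ℓ₂ * L, 1 / ℓ₂ * D, 0;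
     1 / ℓ₂ * Db, 1 / ℓ₂ * N + 1 / ℓ₃ * L, 1 / ℓ₃ * D;
     0, 1 / ℓ₃ * Db, 1 / ℓ₃ * N + 1 / ℓ₄ * L]

/-- The left hand side `Â(Φ) ψ` at the point `x`. -/
def hatLHS (lam : Fin 4 → Point → ℝ) (Φ : StateField) (ψ : Point → ConstraintVec)
    (x : Point) : ConstraintVec :=
  (matrixOp (coeffHat₁ (Φ x)) (fun y => (ψ y).1) x,
   matrixOp (coeffHat₂ (Φ x)) (fun y => (ψ y).2.1) x,
   matrixOp (coeffHat₃ (fun i => lam i x) (Φ x)) (fun y => (ψ y).2.2) x)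

/-- The transformation `f̂(Φ, ∂Φ)` at the point `x`, acting on `ψ = (t, u, v)`. It involves the
values and first derivatives at `x` of `Φ` and of the weights only. -/
def hatRHS (lam : Fin 4 → Point → ℝ) (Φ : StateField) (x : Point) (ψ : ConstraintVec) :
    ConstraintVec :=
  let e₁ := Φ.e₁ x; let e₂ := Φ.e₂ x; let e₃ := Φ.e₃ x; let e₄ := Φ.e₄ x; let e₅ := Φ.e₅ x
  let γ₁ := Φ.γ₁ x; let γ₂ := Φ.γ₂ x; let γ₃ := Φ.γ₃ x; let γ₄ := Φ.γ₄ x; let γ₅ := Φ.γ₅ x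
  let γ₆ := Φ.γ₆ x; let γ₇ := Φ.γ₇ x; let γ₈ := Φ.γ₈ x
  let w₁ := Φ.w₁ x; let w₂ := Φ.w₂ x; let w₃ := Φ.w₃ x; let w₄ := Φ.w₄ x; let w₅ := Φ.w₅ x
  let ℓ₁ := (lam 0 x : ℂ); let ℓ₂ := (lam 1 x : ℂ); let ℓ₃ := (lam 2 x : ℂ)
  let ℓ₄ := (lam 3 x : ℂ)
  let D : (Point → ℂ) → ℂ := fun f => frameDeriv 0 Φ f x
  let Db : (Point → ℂ) → ℂ := fun f => frameDeriv 1 Φ f x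
  let N : (Point → ℂ) → ℂ := fun f => frameDeriv 2 Φ f x
  let L : (Point → ℂ) → ℂ := fun f => frameDeriv 3 Φ f x
  let d₁ : (Point → ℂ) → ℂ := fun f => partialDeriv 0 f x
  let d₂ : (Point → ℂ) → ℂ := fun f => partialDeriv 1 f x
  let d₃ : (Point → ℂ) → ℂ := fun f => partialDeriv 2 f x
  let t₁ := ψ.1 0; let t₂ := ψ.1 1; let t₃ := ψ.1 2; let t₄ := ψ.1 3; let t₅ := ψ.1 4
  let u₁ := ψ.2.1 0; let u₂ := ψ.2.1 1; let u₃ := ψ.2.1 2; let u₄ := ψ.2.1 3; let u₅ := ψ.2.1 4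
  let u₆ := ψ.2.1 5; let u₇ := ψ.2.1 6; let u₈ := ψ.2.1 7; let u₉ := ψ.2.1 8
  let v₁ := ψ.2.2 0; let v₂ := ψ.2.2 1; let v₃ := ψ.2.2 2
  (![-2 * γ₂ * t₁ + (2 * (t₃ * d₃ (conjFun Φ.e₁)).im : ℝ) + (2 * (conj e₁ * u₁).im : ℝ),
     -2 * γ₂ * t₂ + (2 * (t₃ * d₃ (conjFun Φ.e₂)).im : ℝ) + (2 * (conj e₂ * u₁).im : ℝ),
     (-γ₆ + 2 * γ₈) * t₃ - conj γ₇ * conj t₃ - conj t₄ * d₁ Φ.e₃ - conj t₅ * d₂ Φ.e₃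
       + e₃ * u₇ + e₃ * conj u₈,
     Complex.I * (conj γ₃ - γ₄ + γ₅) * t₁ - γ₂ * t₄ - conj γ₁ * conj t₄ - conj t₃ * d₃ Φ.e₄
       + conj e₁ * u₃ - e₁ * conj u₄ + e₁ * u₅ - conj e₁ * conj u₆,
     Complex.I * (conj γ₃ - γ₄ + γ₅) * t₂ - γ₂ * t₅ - conj γ₁ * conj t₅ - conj t₃ * d₃ Φ.e₅
       + conj e₂ * u₃ - e₂ * conj u₄ + e₂ * u₅ - conj e₂ * conj u₆],
   ![-t₃ * d₃ Φ.γ₂ + conj t₃ * d₃ Φ.γ₁ - 3 * γ₂ * u₁ + γ₁ * conj u₁ + 1 / ℓ₁ * v₁,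
     -t₃ * d₃ Φ.γ₄ - conj t₃ * d₃ Φ.γ₃ - γ₄ * u₁ + γ₅ * u₁ - γ₃ * conj u₁ - 2 * γ₂ * u₂
       - γ₁ * u₅ - γ₂ * u₆ - 1 / ℓ₂ * v₂,
     -conj t₃ * d₃ Φ.γ₃ + conj t₃ * d₃ (conjFun Φ.γ₄) + conj γ₃ * u₁ - γ₄ * u₁ + γ₅ * u₁
       - 2 * γ₂ * u₃ + conj γ₁ * u₄ + γ₁ * conj u₄ - γ₁ * u₅ + γ₂ * conj u₆ - 1 / ℓ₂ * v₂,
     t₃ * d₃ Φ.γ₃ - t₃ * d₃ (conjFun Φ.γ₄) + (γ₃ - conj γ₄ + conj γ₅) * u₁ + γ₁ * u₃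
       + γ₁ * conj u₃ - 2 * γ₂ * u₄ + γ₂ * conj u₅ - γ₁ * u₆,
     -t₄ * d₁ Φ.γ₅ - t₅ * d₂ Φ.γ₅ - γ₇ * u₃ + γ₆ * conj u₄ - 2 * γ₆ * u₅ - 2 * γ₈ * u₅
       + 2 * conj γ₈ * u₅ + γ₇ * u₆ + γ₇ * conj u₆ + γ₅ * conj u₇ - γ₅ * u₈ - γ₄ * u₉
       + γ₅ * u₉ + conj γ₃ * u₉,
     conj t₄ * d₁ Φ.γ₅ + conj t₅ * d₂ Φ.γ₅ + γ₆ * conj u₃ - γ₇ * u₄ + conj γ₇ * u₅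
       + γ₇ * conj u₅ - 2 * γ₆ * u₆ + γ₅ * u₇ - γ₅ * conj u₈ + γ₃ * u₉ - conj γ₄ * u₉
       + conj γ₅ * u₉ + 1 / ℓ₃ * v₂,
     -t₃ * d₃ Φ.γ₈ - γ₃ * u₂ + conj γ₄ * u₂ - conj γ₅ * u₂ + γ₃ * conj u₃ + γ₄ * u₄
       - γ₅ * u₄ - γ₄ * conj u₅ - 2 * γ₃ * u₆ + conj γ₄ * u₆ - γ₂ * u₇ - γ₁ * u₈ - 1 / ℓ₂ * v₁,
     -conj t₃ * d₃ Φ.γ₈ + conj γ₃ * u₂ - γ₄ * u₂ + γ₅ * u₂ - γ₄ * u₃ + γ₅ * u₃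
       - γ₃ * conj u₄ + 2 * γ₃ * u₅ - conj γ₄ * u₅ + γ₄ * conj u₆ - conj γ₁ * u₇ - γ₂ * u₈
       + 1 / ℓ₃ * v₃,
     t₄ * d₁ Φ.γ₆ - conj t₄ * d₁ Φ.γ₇ + t₅ * d₂ Φ.γ₆ - conj t₅ * d₂ Φ.γ₇ - 3 * γ₇ * u₇
       + γ₆ * conj u₇ + γ₆ * u₈ + γ₇ * conj u₈ - 3 * γ₆ * u₉ - 2 * γ₈ * u₉ + γ₇ * conj u₉
       + 1 / ℓ₄ * v₃],
   ![-Complex.I * t₁ * d₁ Φ.w₂ - Complex.I * t₂ * d₂ Φ.w₂ + t₃ * d₃ Φ.w₃ - t₄ * d₁ Φ.w₁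
       - t₅ * d₂ Φ.w₁ + 3 * w₃ * u₁ + 2 * w₂ * u₂ + 4 * w₂ * u₃ - 2 * w₂ * u₆ + 4 * w₁ * u₈
       + w₁ * u₉
       + (-4 / ℓ₂ * γ₂ - 2 / ℓ₁ * γ₆ + 3 / ℓ₁ * γ₈ + 1 / ℓ₁ * conj γ₈ + (1 / ℓ₁) ^ 2 * N (weightC lam 0) + (1 / ℓ₂) ^ 2 * L (weightC lam 1)) * v₁
       + ((1 / ℓ₂) ^ 2 * D (weightC lam 1) + 4 / ℓ₂ * γ₃ - 4 / ℓ₂ * conj γ₄ - 1 / ℓ₂ * conj γ₅) * v₂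
       - 2 / ℓ₃ * γ₁ * v₃,
     -Complex.I * t₁ * d₁ Φ.w₃ - Complex.I * t₂ * d₂ Φ.w₃ + t₃ * d₃ Φ.w₄ - t₄ * d₁ Φ.w₂
       - t₅ * d₂ Φ.w₂ + 2 * w₄ * u₁ + 3 * w₃ * u₃ - 3 * w₃ * u₆ + 2 * w₂ * u₈ + 2 * w₂ * u₉
       + (-2 / ℓ₂ * γ₄ - 2 / ℓ₂ * γ₅ + (1 / ℓ₂) ^ 2 * Db (weightC lam 1)) * v₁
       + (-3 / ℓ₃ * γ₂ - 3 / ℓ₂ * γ₆ + 1 / ℓ₂ * γ₈ + 1 / ℓ₂ * conj γ₈ + (1 / ℓ₂) ^ 2 * N (weightC lam 1) + (1 / ℓ₃) ^ 2 * L (weightC lam 2)) * v₂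
       + (1 / ℓ₃ * γ₃ - 3 / ℓ₃ * conj γ₄ - 1 / ℓ₃ * conj γ₅ + (1 / ℓ₃) ^ 2 * D (weightC lam 2)) * v₃,
     -Complex.I * t₁ * d₁ Φ.w₄ - Complex.I * t₂ * d₂ Φ.w₄ + t₃ * d₃ Φ.w₅ - t₄ * d₁ Φ.w₃
       - t₅ * d₂ Φ.w₃ + w₅ * u₁ - 2 * w₄ * u₂ + 2 * w₄ * u₃ - 4 * w₄ * u₆ + 3 * w₃ * u₉
       - 2 / ℓ₂ * γ₇ * v₁ + (-3 / ℓ₃ * γ₅ + (1 / ℓ₃) ^ 2 * Db (weightC lam 2)) * v₂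
       + (-2 / ℓ₄ * γ₂ - 4 / ℓ₃ * γ₆ - 1 / ℓ₃ * γ₈ + 1 / ℓ₃ * conj γ₈ + (1 / ℓ₃) ^ 2 * N (weightC lam 2) + (1 / ℓ₄) ^ 2 * L (weightC lam 3)) * v₃])

/-- `ψ` is a classical solution on `U` of the dual system `Â(Φ) ψ = f̂(Φ, ∂Φ) ψ`. -/
structure IsDualSolution (U : Set Point) (lam : Fin 4 → Point → ℝ) (Φ : StateField)
    (ψ : Point → ConstraintVec) : Prop where
  contDiffOn : ContDiffOn ℝ 1 ψ U
  mem_constraintSpace : ∀ x ∈ U, ψ x ∈ constraintSpace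
  equation : ∀ x ∈ U, hatLHS lam Φ ψ x = hatRHS lam Φ x (ψ x)

/-! ### Problems for the dual system -/

/-- A linear way of prescribing data, in a real vector space `X`, for fields on `U`: a linear
class of admissible fields (those for which the data make sense, such as the fields that extend
continuously to an initial surface, or that have a limit at infinity) and the linear map that
sends an admissible field to its data. -/
structure DataProblem (U : Set Point) (X : Type*) [AddCommGroup X] [Module ℝ X] where
  admissible : Submodule ℝ (U → ConstraintVec)
  data : admissible →ₗ[ℝ] X

/-- The uniqueness part of well-posedness: on `U` an admissible classical solution of the dual
system is determined by its data. Existence and continuous dependence on the data, which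
well-posed problems have in addition, are not required. -/
def DataProblem.HasUniqueness {U : Set Point} {X : Type*} [AddCommGroup X] [Module ℝ X]
    (P : DataProblem U X) (lam : Fin 4 → Point → ℝ) (Φ : StateField) : Prop :=
  ∀ (ψ φ : Point → ConstraintVec) (hψ : U.domRestrict ψ ∈ P.admissible)
    (hφ : U.domRestrict φ ∈ P.admissible),
    IsDualSolution U lam Φ ψ → IsDualSolution U lam Φ φ →
    P.data ⟨U.domRestrict ψ, hψ⟩ = P.data ⟨U.domRestrict φ, hφ⟩ → Set.EqOn ψ φ U

end DualSystem

end

/-! The system (SHS) contains only part of the structure equations of a complex frame `D`, `D̄`,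
`N`, `L` with connection coefficients γ and curvature w, and the constraint field collects what is
left over. The dual system is the resulting Bianchi-type identity: a derivative of a constraint is
again a combination of constraints.

The mechanism rests on the commutators of the frame. The evolution equations for e make `[N, L]` the
exact combination of frame fields prescribed by γ. The other commutators have the prescribed form up
to coordinate derivatives multiplied by t: `[L, D]` has the defect t₃, `[N, D̄]` the defects t₄ and
t₅, `[D, D̄]` the defects t₁ and t₂, and conjugation gives the rest (`comm_L_D` to `comm_D_Db`).

For a component of t or u, the derivative `L` or `N` is commuted past the derivatives inside the
constraint. It then acts on fields that (SHS) evolves, so second derivatives of Φ disappear. First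
derivatives without an evolution equation regroup into other constraints, and what remains is a
polynomial identity in the fields, their conjugates and their derivatives, closed by `ring`.
Derivatives of w that arise this way combine either into a first or last row of the w-system, hence
vanish up to lower order, or into half of a middle row, hence into v.

For v, each middle row of the w-system is a sum λᵢ·bᵢ + λᵢ₊₁·dᵢ₊₁ = 0, with b = `bianchi` and d =
`dualBianchi`. So vᵢ = λᵢ·bᵢ = −λᵢ₊₁·dᵢ₊₁. In each term of `Â₃ v` the representation is chosen whose
weight is the one divided out. Up to derivatives of the weights, the rows become weight-free
expressions such as N b₁ − L d₂ + D b₂, in which the second derivatives of w cancel in pairs through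
commutators (`dual_bianchi₁`, `dual_bianchi₂`, `dual_bianchi₃`).

Hermitian symmetry of the dual system reflects that conjugation swaps `D` and `D̄` and fixes `N` and
`L`. Positivity holds because, in the sum of the ∂₃ and ∂₄ coefficients, `D` and `D̄` contribute
nothing, `N` contributes 1 and `L` contributes e₃ > 0. The last claim compares the constraint field
with the zero solution. -/

set_option linter.unusedSimpArgs false
set_option linter.unusedVariables false

/-- The frame derivatives. -/
local notation "∇[" a "]" => DualSystem.frameDeriv a

/-- The pointwise complex conjugate. -/
local postfix:max "†" => DualSystem.conjFun

/-- The constraint field. -/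
local notation "𝒞" => DualSystem.constraintField

open Complex (I)

namespace DualSystem

/-! ### Calculus of derivatives along the frame -/

section Calculus

variable {Φ : StateField} {f g : Point → ℂ} {x : Point} {a b μ ν : Fin 4}

theorem frameDeriv_const (c : ℂ) : ∇[a] Φ (fun _ => c) x = 0 := by
  simp [frameDeriv, partialDeriv]

theorem frameDeriv_add (hf : DifferentiableAt ℝ f x) (hg : DifferentiableAt ℝ g x) :
    ∇[a] Φ (fun y => f y + g y) x = ∇[a] Φ f x + ∇[a] Φ g x := by
  simp only [frameDeriv, partialDeriv, fderiv_fun_add hf hg, ← Finset.sum_add_distrib]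
  refine Finset.sum_congr rfl fun μ _ => ?_
  simp [mul_add]

theorem frameDeriv_neg : ∇[a] Φ (fun y => -f y) x = -∇[a] Φ f x := by
  simp [frameDeriv, partialDeriv, fderiv_fun_neg]

theorem frameDeriv_sub (hf : DifferentiableAt ℝ f x) (hg : DifferentiableAt ℝ g x) :
    ∇[a] Φ (fun y => f y - g y) x = ∇[a] Φ f x - ∇[a] Φ g x := by
  simp only [frameDeriv, partialDeriv, fderiv_fun_sub hf hg, ← Finset.sum_sub_distrib]
  refine Finset.sum_congr rfl fun μ _ => ?_
  simp [mul_sub]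

theorem frameDeriv_mul (hf : DifferentiableAt ℝ f x) (hg : DifferentiableAt ℝ g x) :
    ∇[a] Φ (fun y => f y * g y) x
      = f x * ∇[a] Φ g x + ∇[a] Φ f x * g x := by
  simp only [frameDeriv, partialDeriv, fderiv_fun_mul hf hg, Finset.mul_sum, Finset.sum_mul,
    ← Finset.sum_add_distrib]
  refine Finset.sum_congr rfl fun μ _ => ?_
  simp
  ring

theorem partialDeriv_conj : partialDeriv μ (conjFun f) x = conj (partialDeriv μ f x) := by
  have := Complex.conjCLE.comp_fderiv (f := f) (x := x)
  have h : conjFun f = ⇑Complex.conjCLE ∘ f := by ext y; simp [conjFun]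
  rw [partialDeriv, h, this]
  simp [partialDeriv]

theorem frameDeriv_congr (h : f =ᶠ[nhds x] g) : ∇[a] Φ f x = ∇[a] Φ g x := by
  simp only [frameDeriv, partialDeriv, h.fderiv_eq]

@[fun_prop]
theorem DifferentiableAt.conjFun (hf : DifferentiableAt ℝ f x) :
    DifferentiableAt ℝ (conjFun f) x :=
  (Complex.conjCLE.differentiable.differentiableAt).comp x hf

/-- The frame index of the complex conjugate frame vector field. -/
def conjIndex : Fin 4 → Fin 4 := ![1, 0, 2, 3]

/-- The reality of e₃, e₄, e₅ makes `N` and `L` real vector fields, while `D̄` is conjugate to `D`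
by construction. -/
theorem frame_conj {p : StateVec} (hp : p ∈ stateSpace) :
    conj (frame p a μ) = frame p (conjIndex a) μ := by
  obtain ⟨h3, h4, h5, -, -⟩ := hp
  rw [← Complex.conj_eq_iff_im] at h3 h4 h5
  fin_cases a <;> fin_cases μ <;> simp [frame, conjIndex, h3, h4, h5]

theorem frameDeriv_conj (hp : Φ x ∈ stateSpace) :
    conj (∇[a] Φ f x) = frameDeriv (conjIndex a) Φ (conjFun f) x := by
  simp [frameDeriv, partialDeriv_conj, frame_conj hp]

/-- Both sides are values of the second Fréchet derivative on basis vectors, and that bilinear map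
is symmetric for a C² function. -/
theorem partialDeriv_comm (hf : ContDiffAt ℝ 2 f x) :
    partialDeriv μ (partialDeriv ν f) x = partialDeriv ν (partialDeriv μ f) x := by
  have hd : DifferentiableAt ℝ (fderiv ℝ f) x :=
    (hf.fderiv_right (m := 1) (by norm_num)).differentiableAt (by norm_num)
  have key : ∀ ν μ, partialDeriv μ (partialDeriv ν f) x
      = fderiv ℝ (fderiv ℝ f) x (Pi.single μ 1) (Pi.single ν 1) := by
    intro ν μ
    have := fderiv_clm_apply hd (differentiableAt_const (Pi.single ν (1 : ℝ) : Point))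
    simp only [partialDeriv]
    erw [this]
    simp
  rw [key, key]
  exact (hf.isSymmSndFDerivAt (by simp)).eq _ _

theorem ContDiffAt.partialDeriv (hf : ContDiffAt ℝ 2 f x) :
    ContDiffAt ℝ 1 (partialDeriv μ f) x :=
  (hf.fderiv_right (m := 1) (by norm_num)).clm_apply contDiffAt_const

theorem contDiffAt_frame (hΦ : ContDiffAt ℝ 2 Φ x) :
    ContDiffAt ℝ 2 (fun y => frame (Φ y) a μ) x := by
  have h1 : ∀ i, ContDiffAt ℝ 2 (fun y => (Φ y).1 i) x := fun i => contDiffAt_pi.1 hΦ.fst i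
  have h2 : ∀ i, ContDiffAt ℝ 2 (fun y => conj ((Φ y).1 i)) x := fun i =>
    Complex.conjCLE.contDiff.contDiffAt.comp x (h1 i)
  fin_cases a <;> fin_cases μ <;> simp [frame] <;>
    first | exact h1 _ | exact h2 _ | exact contDiffAt_const

theorem ContDiffAt.frameDeriv (hΦ : ContDiffAt ℝ 2 Φ x) (hf : ContDiffAt ℝ 2 f x) :
    ContDiffAt ℝ 1 (∇[a] Φ f) x := by
  unfold DualSystem.frameDeriv
  exact ContDiffAt.sum fun μ _ =>
    ((contDiffAt_frame hΦ).of_le (by norm_num)).mul (ContDiffAt.partialDeriv hf)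

theorem frameDeriv_sum {f : Fin 4 → Point → ℂ} (hf : ∀ μ, DifferentiableAt ℝ (f μ) x) :
    ∇[a] Φ (fun y => ∑ μ, f μ y) x = ∑ μ, ∇[a] Φ (f μ) x := by
  simp only [Fin.sum_univ_four]
  rw [frameDeriv_add (by fun_prop) (by fun_prop), frameDeriv_add (by fun_prop) (by fun_prop),
    frameDeriv_add (by fun_prop) (by fun_prop)]

/-- Commutator of two frame vector fields. -/
theorem frameDeriv_comm (hΦ : ContDiffAt ℝ 2 Φ x) (hf : ContDiffAt ℝ 2 f x) (a b : Fin 4) :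
    ∇[a] Φ (∇[b] Φ f) x = ∇[b] Φ (∇[a] Φ f) x
      + ∑ μ, (∇[a] Φ (fun y => frame (Φ y) b μ) x
        - ∇[b] Φ (fun y => frame (Φ y) a μ) x) * partialDeriv μ f x := by
  -- The product rule separates the derivative of the frame coefficients from a second order part.
  -- The latter is symmetric in the two frame fields, so it drops out of the commutator.
  have key : ∀ a b, ∇[a] Φ (∇[b] Φ f) x
      = ∑ μ, ∇[a] Φ (fun y => frame (Φ y) b μ) x * partialDeriv μ f x
        + ∑ μ, ∑ ν, frame (Φ x) b μ * frame (Φ x) a ν * partialDeriv ν (partialDeriv μ f) x := by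
    intro a b
    have hF : ∀ μ, DifferentiableAt ℝ (fun y => frame (Φ y) b μ) x := fun μ =>
      (contDiffAt_frame hΦ).differentiableAt (by norm_num)
    have hp : ∀ μ, DifferentiableAt ℝ (DualSystem.partialDeriv μ f) x := fun μ =>
      (ContDiffAt.partialDeriv hf).differentiableAt (by norm_num)
    change ∇[a] Φ (fun y => ∑ μ, frame (Φ y) b μ * partialDeriv μ f y) x = _
    rw [frameDeriv_sum fun μ => (hF μ).fun_mul (hp μ), ← Finset.sum_add_distrib]
    refine Finset.sum_congr rfl fun μ _ => ?_
    rw [frameDeriv_mul (hF μ) (hp μ), add_comm]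
    congr 1
    simp only [frameDeriv, Finset.mul_sum, mul_assoc]
  rw [key a b, key b a, Finset.sum_comm]
  simp only [sub_mul, Finset.sum_sub_distrib]
  have : ∀ μ ν, frame (Φ x) b ν * frame (Φ x) a μ * partialDeriv μ (partialDeriv ν f) x
      = frame (Φ x) a μ * frame (Φ x) b ν * partialDeriv ν (partialDeriv μ f) x := fun μ ν => by
    rw [partialDeriv_comm hf, mul_comm (frame _ _ _)]
  simp only [this]
  ring

end Calculus

/-! ### Component form of the quasilinear system and of its complex conjugate -/

theorem ofReal_two_mul_re (z : ℂ) : ((2 * z.re : ℝ) : ℂ) = z + conj z := (Complex.add_conj z).symm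

theorem matrixOp_coeffA₁ (Φ : StateField) (x : Point) (i : Fin 5) :
    matrixOp (coeffA₁ (Φ x)) (fun y => (Φ y).1) x i
      = frameDeriv (![3, 3, 2, 3, 3] i) Φ (fun y => (Φ y).1 i) x := by
  simp only [matrixOp, coeffA₁, Matrix.mulVec_diagonal, Finset.sum_apply, frameDeriv]
  fin_cases i <;> rfl

theorem matrixOp_coeffA₂ (Φ : StateField) (x : Point) (i : Fin 8) :
    matrixOp (coeffA₂ (Φ x)) (fun y => (Φ y).2.1) x i
      = frameDeriv (![3, 3, 3, 3, 2, 2, 2, 3] i) Φ (fun y => (Φ y).2.1 i) x := by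
  simp only [matrixOp, coeffA₂, Matrix.mulVec_diagonal, Finset.sum_apply, frameDeriv]
  fin_cases i <;> rfl

theorem conjFun_apply (f : Point → ℂ) (y : Point) : conjFun f y = conj (f y) := rfl

theorem conj_conjFun_apply (f : Point → ℂ) (y : Point) : conj (conjFun f y) = f y := by
  simp [conjFun]

theorem conjFun_conjFun (f : Point → ℂ) : conjFun (conjFun f) = f := by
  ext y
  simp [conjFun]

/-- `Φ` is a `C²` solution of the quasilinear system in a neighbourhood of `x`, with positive
`C¹` weights. -/
structure SolvesNear (lam : Fin 4 → Point → ℝ) (Φ : StateField) (x : Point) : Prop where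
  lam_pos : ∀ᶠ y in nhds x, ∀ i, 0 < lam i y
  contDiffAt_lam : ∀ i, ContDiffAt ℝ 1 (lam i) x
  contDiffAt : ContDiffAt ℝ 2 Φ x
  mem_stateSpace : ∀ᶠ y in nhds x, Φ y ∈ stateSpace
  equation : ∀ᶠ y in nhds x, shsLHS lam Φ y = shsRHS (fun i => lam i y) (Φ y)

namespace SolvesNear

variable {lam : Fin 4 → Point → ℝ} {Φ : StateField} {x : Point}

theorem fact (h : SolvesNear lam Φ x) : Fact (ContDiffAt ℝ 2 Φ x) := ⟨h.contDiffAt⟩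

/-- Reality is recorded as an identity of germs, because these fields also occur under frame
derivatives. The same holds for the other real components. -/
theorem conj_e₃ (h : SolvesNear lam Φ x) : Φ.e₃† =ᶠ[nhds x] Φ.e₃ := by
  filter_upwards [h.mem_stateSpace] with y hy
  exact Complex.conj_eq_iff_im.2 hy.1

theorem conj_e₄ (h : SolvesNear lam Φ x) : Φ.e₄† =ᶠ[nhds x] Φ.e₄ := by
  filter_upwards [h.mem_stateSpace] with y hy
  exact Complex.conj_eq_iff_im.2 hy.2.1

theorem conj_e₅ (h : SolvesNear lam Φ x) : Φ.e₅† =ᶠ[nhds x] Φ.e₅ := by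
  filter_upwards [h.mem_stateSpace] with y hy
  exact Complex.conj_eq_iff_im.2 hy.2.2.1

theorem conj_γ₂ (h : SolvesNear lam Φ x) : Φ.γ₂† =ᶠ[nhds x] Φ.γ₂ := by
  filter_upwards [h.mem_stateSpace] with y hy
  exact Complex.conj_eq_iff_im.2 hy.2.2.2.1

theorem conj_γ₆ (h : SolvesNear lam Φ x) : Φ.γ₆† =ᶠ[nhds x] Φ.γ₆ := by
  filter_upwards [h.mem_stateSpace] with y hy
  exact Complex.conj_eq_iff_im.2 hy.2.2.2.2

theorem equation_e (h : SolvesNear lam Φ x) (i : Fin 5) : ∀ᶠ y in nhds x,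
    frameDeriv (![3, 3, 2, 3, 3] i) Φ (fun y => (Φ y).1 i) y
      = (shsRHS (fun i => lam i y) (Φ y)).1 i := by
  filter_upwards [h.equation] with y hy
  exact (matrixOp_coeffA₁ Φ y i).symm.trans (congrFun (congrArg Prod.fst hy) i)

theorem equation_γ (h : SolvesNear lam Φ x) (i : Fin 8) : ∀ᶠ y in nhds x,
    frameDeriv (![3, 3, 3, 3, 2, 2, 2, 3] i) Φ (fun y => (Φ y).2.1 i) y
      = (shsRHS (fun i => lam i y) (Φ y)).2.1 i := by
  filter_upwards [h.equation] with y hy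
  exact (matrixOp_coeffA₂ Φ y i).symm.trans (congrFun (congrArg (·.2.1) hy) i)

/-- The constraints contain conjugated fields, whose evolution is obtained by conjugating (SHS).
Afterwards a field and its conjugate are treated as independent unknowns, so that every verification
becomes a polynomial identity. -/
theorem conj_equation (h : SolvesNear lam Φ x) {a : Fin 4} {f R : Point → ℂ}
    (hf : ∇[a] Φ f =ᶠ[nhds x] R) : ∀ᶠ y in nhds x,
    frameDeriv (conjIndex a) Φ (conjFun f) y = conj (R y) := by
  filter_upwards [hf, h.mem_stateSpace] with y hy hr
  rw [← frameDeriv_conj hr, hy]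

theorem e₁_eq (h : SolvesNear lam Φ x) :
    ∇[3] Φ Φ.e₁ =ᶠ[nhds x] fun y => -Φ.e₁ y * Φ.γ₂ y - Φ.e₁† y * Φ.γ₁ y := by
  refine (h.equation_e 0).mono fun y hy => hy.trans ?_
  simp [shsRHS, StateField.e₁, StateField.γ₁, StateField.γ₂, conjFun]

theorem e₂_eq (h : SolvesNear lam Φ x) :
    ∇[3] Φ Φ.e₂ =ᶠ[nhds x] fun y => -Φ.e₂ y * Φ.γ₂ y - Φ.e₂† y * Φ.γ₁ y := by
  refine (h.equation_e 1).mono fun y hy => hy.trans ?_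
  simp [shsRHS, StateField.e₂, StateField.γ₁, StateField.γ₂, conjFun]

theorem e₃_eq (h : SolvesNear lam Φ x) :
    ∇[2] Φ Φ.e₃ =ᶠ[nhds x] fun y => Φ.e₃ y * (Φ.γ₈ y + Φ.γ₈† y) := by
  refine (h.equation_e 2).mono fun y hy => hy.trans ?_
  simp only [shsRHS, ofReal_two_mul_re]
  simp [StateField.e₃, StateField.γ₈, conjFun]

theorem e₄_eq (h : SolvesNear lam Φ x) :
    ∇[3] Φ Φ.e₄ =ᶠ[nhds x] fun y => -Φ.e₁ y * Φ.γ₄ y + Φ.e₁ y * Φ.γ₅ y + Φ.e₁ y * Φ.γ₃† y +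
        (-Φ.e₁† y * Φ.γ₄† y + Φ.e₁† y * Φ.γ₅† y + Φ.e₁† y
        * Φ.γ₃ y) := by
  refine (h.equation_e 3).mono fun y hy => hy.trans ?_
  simp only [shsRHS, ofReal_two_mul_re]
  simp [StateField.e₁, StateField.γ₃, StateField.γ₄, StateField.γ₅, conjFun]

theorem e₅_eq (h : SolvesNear lam Φ x) :
    ∇[3] Φ Φ.e₅ =ᶠ[nhds x] fun y => -Φ.e₂ y * Φ.γ₄ y + Φ.e₂ y * Φ.γ₅ y + Φ.e₂ y * Φ.γ₃† y +
        (-Φ.e₂† y * Φ.γ₄† y + Φ.e₂† y * Φ.γ₅† y + Φ.e₂† y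
        * Φ.γ₃ y) := by
  refine (h.equation_e 4).mono fun y hy => hy.trans ?_
  simp only [shsRHS, ofReal_two_mul_re]
  simp [StateField.e₂, StateField.γ₃, StateField.γ₄, StateField.γ₅, conjFun]

theorem γ₁_eq (h : SolvesNear lam Φ x) :
    ∇[3] Φ Φ.γ₁ =ᶠ[nhds x] fun y => -2 * Φ.γ₁ y * Φ.γ₂ y - Φ.w₁ y := by
  refine (h.equation_γ 0).mono fun y hy => hy.trans ?_
  simp [shsRHS, StateField.w₁, StateField.γ₁, StateField.γ₂]

theorem γ₂_eq (h : SolvesNear lam Φ x) :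
    ∇[3] Φ Φ.γ₂ =ᶠ[nhds x] fun y => -(Φ.γ₁ y * Φ.γ₁† y) - Φ.γ₂ y * Φ.γ₂ y := by
  refine (h.equation_γ 1).mono fun y hy => hy.trans ?_
  simp [shsRHS, ← Complex.mul_conj', StateField.γ₁, StateField.γ₂, conjFun]

theorem γ₃_eq (h : SolvesNear lam Φ x) :
    ∇[3] Φ Φ.γ₃ =ᶠ[nhds x] fun y => Φ.γ₁ y * Φ.γ₄ y - Φ.γ₁ y * Φ.γ₅ y - Φ.γ₂ y * Φ.γ₃ y -
        Φ.w₂ y := by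
  refine (h.equation_γ 2).mono fun y hy => hy.trans ?_
  simp [shsRHS, StateField.w₂, StateField.γ₁, StateField.γ₂, StateField.γ₃, StateField.γ₄,
      StateField.γ₅]

theorem γ₄_eq (h : SolvesNear lam Φ x) :
    ∇[3] Φ Φ.γ₄ =ᶠ[nhds x] fun y => -Φ.γ₂ y * Φ.γ₄ y + Φ.γ₂ y * Φ.γ₅ y + Φ.γ₃ y * Φ.γ₁† y := by
  refine (h.equation_γ 3).mono fun y hy => hy.trans ?_
  simp [shsRHS, StateField.γ₁, StateField.γ₂, StateField.γ₃, StateField.γ₄, StateField.γ₅, conjFun]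

theorem γ₅_eq (h : SolvesNear lam Φ x) :
    ∇[2] Φ Φ.γ₅ =ᶠ[nhds x] fun y => -Φ.γ₃ y * Φ.γ₇ y + Φ.γ₄ y * Φ.γ₆ y - Φ.γ₅ y * Φ.γ₆ y -
        Φ.γ₅ y * Φ.γ₈ y + Φ.γ₅ y * Φ.γ₈† y - Φ.γ₆ y * Φ.γ₃† y + Φ.γ₇ y * Φ.γ₄† y
        - Φ.γ₇ y * Φ.γ₅† y + Φ.w₄ y := by
  refine (h.equation_γ 4).mono fun y hy => hy.trans ?_
  simp [shsRHS, StateField.w₄, StateField.γ₃, StateField.γ₄, StateField.γ₅, StateField.γ₆,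
      StateField.γ₇, StateField.γ₈, conjFun]

theorem γ₆_eq (h : SolvesNear lam Φ x) :
    ∇[2] Φ Φ.γ₆ =ᶠ[nhds x] fun y => -Φ.γ₆ y * Φ.γ₆ y - Φ.γ₆ y * (Φ.γ₈ y + Φ.γ₈† y)
        - Φ.γ₇ y * Φ.γ₇† y := by
  refine (h.equation_γ 5).mono fun y hy => hy.trans ?_
  simp only [shsRHS, ofReal_two_mul_re]
  simp [← Complex.mul_conj', StateField.γ₆, StateField.γ₇, StateField.γ₈, conjFun]

theorem γ₇_eq (h : SolvesNear lam Φ x) :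
    ∇[2] Φ Φ.γ₇ =ᶠ[nhds x] fun y => -2 * Φ.γ₆ y * Φ.γ₇ y - 3 * Φ.γ₇ y * Φ.γ₈ y + Φ.γ₇ y *
        Φ.γ₈† y - Φ.w₅ y := by
  refine (h.equation_γ 6).mono fun y hy => hy.trans ?_
  simp [shsRHS, StateField.w₅, StateField.γ₆, StateField.γ₇, StateField.γ₈, conjFun]

theorem γ₈_eq (h : SolvesNear lam Φ x) :
    ∇[3] Φ Φ.γ₈ =ᶠ[nhds x] fun y => -2 * Φ.γ₃ y * Φ.γ₄ y + 2 * Φ.γ₃ y * Φ.γ₅ y + Φ.γ₃ y *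
        Φ.γ₃† y + Φ.γ₄ y * Φ.γ₄† y - Φ.γ₄ y * Φ.γ₅† y - Φ.γ₅ y * Φ.γ₄† y +
        Φ.w₃ y := by
  refine (h.equation_γ 7).mono fun y hy => hy.trans ?_
  simp [shsRHS, StateField.w₃, StateField.γ₃, StateField.γ₄, StateField.γ₅, conjFun]

theorem conj_e₁_eq (h : SolvesNear lam Φ x) :
    ∇[3] Φ Φ.e₁† =ᶠ[nhds x] fun y => -Φ.e₁† y * Φ.γ₂ y - Φ.e₁ y * Φ.γ₁† y := by
  filter_upwards [h.conj_equation h.e₁_eq, h.conj_γ₂, h.conj_γ₆] with y hy h2 h6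
  exact hy.trans (by simp only [map_add, map_sub, map_mul, map_neg, map_ofNat, ← conjFun_apply,
    conjFun_conjFun, h2, h6])

theorem conj_e₂_eq (h : SolvesNear lam Φ x) :
    ∇[3] Φ Φ.e₂† =ᶠ[nhds x] fun y => -Φ.e₂† y * Φ.γ₂ y - Φ.e₂ y * Φ.γ₁† y := by
  filter_upwards [h.conj_equation h.e₂_eq, h.conj_γ₂, h.conj_γ₆] with y hy h2 h6
  exact hy.trans (by simp only [map_add, map_sub, map_mul, map_neg, map_ofNat, ← conjFun_apply,
    conjFun_conjFun, h2, h6])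

theorem conj_γ₃_eq (h : SolvesNear lam Φ x) :
    ∇[3] Φ Φ.γ₃† =ᶠ[nhds x] fun y => Φ.γ₁† y * Φ.γ₄† y - Φ.γ₁† y * Φ.γ₅† y - Φ.γ₂ y * Φ.γ₃† y -
        Φ.w₂† y := by
  filter_upwards [h.conj_equation h.γ₃_eq, h.conj_γ₂, h.conj_γ₆] with y hy h2 h6
  exact hy.trans (by simp only [map_add, map_sub, map_mul, map_neg, map_ofNat, ← conjFun_apply,
    conjFun_conjFun, h2, h6])

theorem conj_γ₄_eq (h : SolvesNear lam Φ x) :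
    ∇[3] Φ Φ.γ₄† =ᶠ[nhds x] fun y => -Φ.γ₂ y * Φ.γ₄† y + Φ.γ₂ y * Φ.γ₅† y + Φ.γ₃† y * Φ.γ₁ y := by
  filter_upwards [h.conj_equation h.γ₄_eq, h.conj_γ₂, h.conj_γ₆] with y hy h2 h6
  exact hy.trans (by simp only [map_add, map_sub, map_mul, map_neg, map_ofNat, ← conjFun_apply,
    conjFun_conjFun, h2, h6])

theorem conj_γ₅_eq (h : SolvesNear lam Φ x) :
    ∇[2] Φ Φ.γ₅† =ᶠ[nhds x] fun y => -Φ.γ₃† y * Φ.γ₇† y + Φ.γ₄† y * Φ.γ₆ y - Φ.γ₅† y * Φ.γ₆ y -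
        Φ.γ₅† y * Φ.γ₈† y + Φ.γ₅† y *
        Φ.γ₈ y - Φ.γ₆ y * Φ.γ₃ y + Φ.γ₇† y * Φ.γ₄ y - Φ.γ₇† y * Φ.γ₅ y + Φ.w₄† y
        := by
  filter_upwards [h.conj_equation h.γ₅_eq, h.conj_γ₂, h.conj_γ₆] with y hy h2 h6
  exact hy.trans (by simp only [map_add, map_sub, map_mul, map_neg, map_ofNat, ← conjFun_apply,
    conjFun_conjFun, h2, h6])

theorem conj_γ₈_eq (h : SolvesNear lam Φ x) :
    ∇[3] Φ Φ.γ₈† =ᶠ[nhds x] fun y => -2 * Φ.γ₃† y * Φ.γ₄† y + 2 *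
        Φ.γ₃† y * Φ.γ₅† y + Φ.γ₃† y * Φ.γ₃ y + Φ.γ₄† y * Φ.γ₄ y - Φ.γ₄† y * Φ.γ₅ y - Φ.γ₅† y *
            Φ.γ₄ y + Φ.w₃† y := by
  filter_upwards [h.conj_equation h.γ₈_eq, h.conj_γ₂, h.conj_γ₆] with y hy h2 h6
  exact hy.trans (by simp only [map_add, map_sub, map_mul, map_neg, map_ofNat, ← conjFun_apply,
    conjFun_conjFun, h2, h6])

end SolvesNear

/-! ### Regularity of the components and of their frame derivatives -/

@[fun_prop]
theorem ContDiffAt.conjFun {f : Point → ℂ} {x : Point} {n : WithTop ℕ∞}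
    (hf : ContDiffAt ℝ n f x) : ContDiffAt ℝ n (conjFun f) x :=
  Complex.conjCLE.contDiff.contDiffAt.comp x hf

/-- Two orders of regularity are used: C² for a component about to be differentiated twice, C¹ for
one that enters a product. Carrying the bound and the regularity of Φ as `Fact` instances lets
`fun_prop` discharge both without explicit hypotheses. -/
instance : Fact ((1 : WithTop ℕ∞) ≤ 2) := ⟨one_le_two⟩

instance : Fact ((2 : WithTop ℕ∞) ≤ 2) := ⟨le_rfl⟩

section Regularity

variable {Φ : StateField} {x : Point} {f : Point → ℂ} [hΦ : Fact (ContDiffAt ℝ 2 Φ x)]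
  {n : WithTop ℕ∞} [hn : Fact (n ≤ 2)]

theorem contDiffAt_e (i : Fin 5) : ContDiffAt ℝ 2 (fun y => (Φ y).1 i) x :=
  contDiffAt_pi.1 hΦ.out.fst i

theorem contDiffAt_γ (i : Fin 8) : ContDiffAt ℝ 2 (fun y => (Φ y).2.1 i) x :=
  contDiffAt_pi.1 hΦ.out.snd.fst i

theorem contDiffAt_w (i : Fin 5) : ContDiffAt ℝ 2 (fun y => (Φ y).2.2 i) x :=
  contDiffAt_pi.1 hΦ.out.snd.snd i

@[fun_prop] theorem contDiffAt_e₁ : ContDiffAt ℝ n Φ.e₁ x :=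
  (contDiffAt_e 0).of_le hn.out
@[fun_prop] theorem contDiffAt_e₂ : ContDiffAt ℝ n Φ.e₂ x :=
  (contDiffAt_e 1).of_le hn.out
@[fun_prop] theorem contDiffAt_e₃ : ContDiffAt ℝ n Φ.e₃ x :=
  (contDiffAt_e 2).of_le hn.out
@[fun_prop] theorem contDiffAt_e₄ : ContDiffAt ℝ n Φ.e₄ x :=
  (contDiffAt_e 3).of_le hn.out
@[fun_prop] theorem contDiffAt_e₅ : ContDiffAt ℝ n Φ.e₅ x :=
  (contDiffAt_e 4).of_le hn.out
@[fun_prop] theorem contDiffAt_γ₁ : ContDiffAt ℝ n Φ.γ₁ x :=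
  (contDiffAt_γ 0).of_le hn.out
@[fun_prop] theorem contDiffAt_γ₂ : ContDiffAt ℝ n Φ.γ₂ x :=
  (contDiffAt_γ 1).of_le hn.out
@[fun_prop] theorem contDiffAt_γ₃ : ContDiffAt ℝ n Φ.γ₃ x :=
  (contDiffAt_γ 2).of_le hn.out
@[fun_prop] theorem contDiffAt_γ₄ : ContDiffAt ℝ n Φ.γ₄ x :=
  (contDiffAt_γ 3).of_le hn.out
@[fun_prop] theorem contDiffAt_γ₅ : ContDiffAt ℝ n Φ.γ₅ x :=
  (contDiffAt_γ 4).of_le hn.out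
@[fun_prop] theorem contDiffAt_γ₆ : ContDiffAt ℝ n Φ.γ₆ x :=
  (contDiffAt_γ 5).of_le hn.out
@[fun_prop] theorem contDiffAt_γ₇ : ContDiffAt ℝ n Φ.γ₇ x :=
  (contDiffAt_γ 6).of_le hn.out
@[fun_prop] theorem contDiffAt_γ₈ : ContDiffAt ℝ n Φ.γ₈ x :=
  (contDiffAt_γ 7).of_le hn.out
@[fun_prop] theorem contDiffAt_w₁ : ContDiffAt ℝ n Φ.w₁ x :=
  (contDiffAt_w 0).of_le hn.out
@[fun_prop] theorem contDiffAt_w₂ : ContDiffAt ℝ n Φ.w₂ x :=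
  (contDiffAt_w 1).of_le hn.out
@[fun_prop] theorem contDiffAt_w₃ : ContDiffAt ℝ n Φ.w₃ x :=
  (contDiffAt_w 2).of_le hn.out
@[fun_prop] theorem contDiffAt_w₄ : ContDiffAt ℝ n Φ.w₄ x :=
  (contDiffAt_w 3).of_le hn.out
@[fun_prop] theorem contDiffAt_w₅ : ContDiffAt ℝ n Φ.w₅ x :=
  (contDiffAt_w 4).of_le hn.out

@[fun_prop]
theorem contDiffAt_frameDeriv {a : Fin 4} (hf : ContDiffAt ℝ 2 f x) :
    ContDiffAt ℝ 1 (∇[a] Φ f) x :=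
  ContDiffAt.frameDeriv hΦ.out hf

end Regularity

/-- These expansions turn the coordinate form of a commutator back into frame derivatives. None is
needed for `N`: its ∂₄ coefficient is constant and the other frame fields have none, so ∂₄ never
occurs in a commutator. -/
theorem frameDeriv_zero (Φ : StateField) (f : Point → ℂ) (x : Point) : ∇[0] Φ f x
    = Φ.e₁ x * partialDeriv 0 f x + Φ.e₂ x * partialDeriv 1 f x := by
  simp [frameDeriv, Fin.sum_univ_four, frame, StateField.e₁, StateField.e₂]

theorem frameDeriv_one (Φ : StateField) (f : Point → ℂ) (x : Point) : ∇[1] Φ f x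
    = Φ.e₁† x * partialDeriv 0 f x + Φ.e₂† x * partialDeriv 1 f x := by
  simp [frameDeriv, Fin.sum_univ_four, frame, StateField.e₁, StateField.e₂, conjFun]

theorem frameDeriv_three (Φ : StateField) (f : Point → ℂ) (x : Point) : ∇[3] Φ f x
    = Φ.e₃ x * partialDeriv 2 f x := by
  simp [frameDeriv, Fin.sum_univ_four, frame, StateField.e₃]

/-! ### Components of the constraint field -/

/-- Replacing the imaginary part by a difference of conjugates makes t₁ and t₂ accessible to the
product and commutator rules for complex valued functions. -/
theorem ofReal_neg_two_mul_im (z : ℂ) :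
    -((2 * z.im : ℝ) : ℂ) = I * (z - conj z) := by
  rw [Complex.sub_conj]
  push_cast
  linear_combination 2 * (z.im : ℂ) * (-Complex.I_mul_I)

namespace SolvesNear

variable {lam : Fin 4 → Point → ℝ} {Φ : StateField} {x : Point}

theorem constraint_t₁ (h : SolvesNear lam Φ x) :
    (fun y => (𝒞 lam Φ y).1 0) =ᶠ[nhds x] fun y =>
      I * (∇[0] Φ Φ.e₁† y + Φ.e₁† y * Φ.γ₃ y + Φ.e₁† y *
          Φ.γ₄† y - (∇[1] Φ Φ.e₁ y + Φ.e₁ y * Φ.γ₃† y + Φ.e₁ y * Φ.γ₄ y)) := by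
  filter_upwards [h.mem_stateSpace] with y hy
  have h0 : (𝒞 lam Φ y).1 0 = I * (∇[0] Φ Φ.e₁† y
      + Φ.e₁† y * Φ.γ₃ y + Φ.e₁† y * Φ.γ₄† y
      - conj (∇[0] Φ Φ.e₁† y
      + Φ.e₁† y * Φ.γ₃ y + Φ.e₁† y * Φ.γ₄† y)) := by
    rw [← ofReal_neg_two_mul_im]
    rfl
  rw [h0, map_add, map_add, frameDeriv_conj hy]
  simp only [map_mul, ← conjFun_apply, conjFun_conjFun]
  rfl

theorem constraint_t₂ (h : SolvesNear lam Φ x) :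
    (fun y => (𝒞 lam Φ y).1 1) =ᶠ[nhds x] fun y =>
      I * (∇[0] Φ Φ.e₂† y + Φ.e₂† y * Φ.γ₃ y + Φ.e₂† y *
          Φ.γ₄† y - (∇[1] Φ Φ.e₂ y + Φ.e₂ y * Φ.γ₃† y + Φ.e₂ y * Φ.γ₄ y)) := by
  filter_upwards [h.mem_stateSpace] with y hy
  have h0 : (𝒞 lam Φ y).1 1 = I * (∇[0] Φ Φ.e₂† y
      + Φ.e₂† y * Φ.γ₃ y + Φ.e₂† y * Φ.γ₄† y
      - conj (∇[0] Φ Φ.e₂† y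
      + Φ.e₂† y * Φ.γ₃ y + Φ.e₂† y * Φ.γ₄† y)) := by
    rw [← ofReal_neg_two_mul_im]
    rfl
  rw [h0, map_add, map_add, frameDeriv_conj hy]
  simp only [map_mul, ← conjFun_apply, conjFun_conjFun]
  rfl

end SolvesNear

section Components

variable (lam : Fin 4 → Point → ℝ) (Φ : StateField) (y : Point)

theorem constraint_t₃ : (𝒞 lam Φ y).1 2 =
    ∇[0] Φ Φ.e₃ y - Φ.e₃ y * Φ.γ₃ y + Φ.e₃ y * Φ.γ₄† y + Φ.e₃ y * Φ.γ₅† y :=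
        rfl

theorem constraint_t₄ : (𝒞 lam Φ y).1 3 =
    ∇[1] Φ Φ.e₄ y - ∇[2] Φ Φ.e₁† y - Φ.e₁ y * Φ.γ₇ y - Φ.e₁† y * Φ.γ₆ y + Φ.e₁† y * Φ.γ₈† y -
      Φ.e₁† y * Φ.γ₈ y := rfl

theorem constraint_t₅ : (𝒞 lam Φ y).1 4 =
    ∇[1] Φ Φ.e₅ y - ∇[2] Φ Φ.e₂† y - Φ.e₂ y * Φ.γ₇ y - Φ.e₂† y * Φ.γ₆ y + Φ.e₂† y * Φ.γ₈† y -
      Φ.e₂† y * Φ.γ₈ y := rfl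

theorem constraint_u₁ : (𝒞 lam Φ y).2.1 0 =
    ∇[0] Φ Φ.γ₂ y - ∇[1] Φ Φ.γ₁ y + Φ.w₂ y - 3 * Φ.γ₁ y * Φ.γ₄ y - Φ.γ₁ y * Φ.γ₃† y - Φ.γ₂ y *
      Φ.γ₃ y + Φ.γ₂ y * Φ.γ₄† y := rfl

theorem constraint_u₂ : (𝒞 lam Φ y).2.1 1 =
    ∇[0] Φ Φ.γ₄ y + ∇[1] Φ Φ.γ₃ y - Φ.w₃ y + 2 * Φ.γ₃ y * Φ.γ₄ y + Φ.γ₁ y * Φ.γ₇ y - Φ.γ₂ y * Φ.γ₆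
      y + Φ.γ₃ y * Φ.γ₃† y + Φ.γ₄ y * Φ.γ₄† y := rfl

theorem constraint_u₃ : (𝒞 lam Φ y).2.1 2 =
    ∇[1] Φ Φ.γ₃ y - ∇[1] Φ Φ.γ₄† y + ∇[2] Φ Φ.γ₂ y - Φ.w₃ y + 2 * Φ.γ₃ y * Φ.γ₄ y - 2 * Φ.γ₄ y *
      Φ.γ₄† y + Φ.γ₁ y * Φ.γ₇ y + Φ.γ₂ y * Φ.γ₆ y - Φ.γ₂ y * Φ.γ₈ y - Φ.γ₂ y * Φ.γ₈† y := rfl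

theorem constraint_u₄ : (𝒞 lam Φ y).2.1 3 =
    ∇[0] Φ Φ.γ₄† y - ∇[0] Φ Φ.γ₃ y - ∇[2] Φ Φ.γ₁ y + 3 * Φ.γ₁ y * Φ.γ₈ y + 2 * Φ.γ₃ y * Φ.γ₃ y - 2
      * Φ.γ₃ y * Φ.γ₄† y - Φ.γ₁ y * Φ.γ₆ y - Φ.γ₁ y * Φ.γ₈† y - Φ.γ₂ y * Φ.γ₇† y := rfl

theorem constraint_u₅ : (𝒞 lam Φ y).2.1 4 =
    ∇[1] Φ Φ.γ₅ y - ∇[3] Φ Φ.γ₇ y - Φ.γ₂ y * Φ.γ₇ y - Φ.γ₄ y * Φ.γ₅ y + Φ.γ₅ y * Φ.γ₅ y - Φ.γ₅ y *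
      Φ.γ₃† y - Φ.γ₆ y * Φ.γ₁† y := rfl

theorem constraint_u₆ : (𝒞 lam Φ y).2.1 5 =
    ∇[3] Φ Φ.γ₆ y - ∇[0] Φ Φ.γ₅ y - Φ.w₃ y + Φ.γ₁ y * Φ.γ₇ y + Φ.γ₂ y * Φ.γ₆ y - Φ.γ₃ y * Φ.γ₅ y -
      Φ.γ₅ y * Φ.γ₄† y - Φ.γ₅ y * Φ.γ₅† y := rfl

theorem constraint_u₇ : (𝒞 lam Φ y).2.1 6 =
    ∇[0] Φ Φ.γ₈ y - ∇[2] Φ Φ.γ₃ y - 2 * Φ.γ₃ y * Φ.γ₆ y + Φ.γ₃ y * Φ.γ₈ y - Φ.γ₃ y * Φ.γ₈† y +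
      Φ.γ₄ y * Φ.γ₇† y + Φ.γ₆ y * Φ.γ₄† y := rfl

theorem constraint_u₈ : (𝒞 lam Φ y).2.1 7 =
    ∇[2] Φ Φ.γ₄ y + ∇[1] Φ Φ.γ₈ y + Φ.w₄ y - 2 * Φ.γ₃ y * Φ.γ₇ y + Φ.γ₄ y * Φ.γ₆ y + Φ.γ₄ y * Φ.γ₈
      y - Φ.γ₄ y * Φ.γ₈† y + Φ.γ₇ y * Φ.γ₄† y := rfl

theorem constraint_u₉ : (𝒞 lam Φ y).2.1 8 =
    ∇[0] Φ Φ.γ₇ y - ∇[1] Φ Φ.γ₆ y - Φ.w₄ y + 3 * Φ.γ₃ y * Φ.γ₇ y + Φ.γ₄ y * Φ.γ₆ y - Φ.γ₆ y *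
      Φ.γ₃† y + Φ.γ₇ y * Φ.γ₄† y := rfl

theorem constraint_v₁ : (𝒞 lam Φ y).2.2 0 =
    weightC lam 0 y * (∇[1] Φ Φ.w₁ y + ∇[3] Φ Φ.w₂ y + 4 * Φ.γ₂ y * Φ.w₂ y + 4 * Φ.γ₄ y * Φ.w₁ y +
      Φ.γ₅ y * Φ.w₁ y) := rfl

theorem constraint_v₂ : (𝒞 lam Φ y).2.2 1 =
    weightC lam 1 y * (∇[1] Φ Φ.w₂ y + ∇[3] Φ Φ.w₃ y + 3 * Φ.γ₂ y * Φ.w₃ y + 2 * Φ.γ₄ y * Φ.w₂ y +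
      2 * Φ.γ₅ y * Φ.w₂ y + Φ.γ₇ y * Φ.w₁ y) := rfl

theorem constraint_v₃ : (𝒞 lam Φ y).2.2 2 =
    weightC lam 2 y * (∇[1] Φ Φ.w₃ y + ∇[3] Φ Φ.w₄ y + 2 * Φ.γ₂ y * Φ.w₄ y + 3 * Φ.γ₅ y * Φ.w₃ y +
      2 * Φ.γ₇ y * Φ.w₂ y) := rfl

end Components

namespace SolvesNear

variable {lam : Fin 4 → Point → ℝ} {Φ : StateField} {x : Point}

theorem conj_frameDeriv (h : SolvesNear lam Φ x) (f : Point → ℂ) :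
    conj (∇[0] Φ f x) = ∇[1] Φ (conjFun f) x ∧
    conj (∇[1] Φ f x) = ∇[0] Φ (conjFun f) x ∧
    conj (∇[2] Φ f x) = ∇[2] Φ (conjFun f) x ∧
    conj (∇[3] Φ f x) = ∇[3] Φ (conjFun f) x :=
  ⟨frameDeriv_conj h.mem_stateSpace.self_of_nhds, frameDeriv_conj h.mem_stateSpace.self_of_nhds,
    frameDeriv_conj h.mem_stateSpace.self_of_nhds, frameDeriv_conj h.mem_stateSpace.self_of_nhds⟩

/-- Conjugates of constraints occur on the right of the dual system, since conjugation turns a `D̄`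
defect into a `D` defect. Conjugates of u₂ and of v never occur there, and t₁, t₂ are real. -/
theorem conj_constraint_t₃ (h : SolvesNear lam Φ x) :
    conj ((𝒞 lam Φ x).1 2)
    = ∇[1] Φ Φ.e₃ x - Φ.e₃ x * Φ.γ₃† x + Φ.e₃ x * Φ.γ₄ x + Φ.e₃ x * Φ.γ₅ x := by
  rw [constraint_t₃]
  simp only [map_add, map_sub, map_mul, map_ofNat, h.conj_frameDeriv, ← conjFun_apply,
    conjFun_conjFun, h.conj_e₃.eq_of_nhds, frameDeriv_congr h.conj_e₃]

theorem conj_constraint_t₄ (h : SolvesNear lam Φ x) :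
    conj ((𝒞 lam Φ x).1 3)
    = ∇[0] Φ Φ.e₄ x - ∇[2] Φ Φ.e₁ x - Φ.e₁† x * Φ.γ₇† x - Φ.e₁ x * Φ.γ₆ x + Φ.e₁ x * Φ.γ₈ x - Φ.e₁
      x * Φ.γ₈† x := by
  rw [constraint_t₄]
  simp only [map_add, map_sub, map_mul, map_ofNat, h.conj_frameDeriv, ← conjFun_apply,
    conjFun_conjFun, h.conj_e₄.eq_of_nhds, h.conj_γ₆.eq_of_nhds, frameDeriv_congr h.conj_e₄]

theorem conj_constraint_t₅ (h : SolvesNear lam Φ x) :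
    conj ((𝒞 lam Φ x).1 4)
    = ∇[0] Φ Φ.e₅ x - ∇[2] Φ Φ.e₂ x - Φ.e₂† x * Φ.γ₇† x - Φ.e₂ x * Φ.γ₆ x + Φ.e₂ x * Φ.γ₈ x - Φ.e₂
      x * Φ.γ₈† x := by
  rw [constraint_t₅]
  simp only [map_add, map_sub, map_mul, map_ofNat, h.conj_frameDeriv, ← conjFun_apply,
    conjFun_conjFun, h.conj_e₅.eq_of_nhds, h.conj_γ₆.eq_of_nhds, frameDeriv_congr h.conj_e₅]

theorem conj_constraint_u₁ (h : SolvesNear lam Φ x) :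
    conj ((𝒞 lam Φ x).2.1 0)
    = ∇[1] Φ Φ.γ₂ x - ∇[0] Φ Φ.γ₁† x + Φ.w₂† x - 3 * Φ.γ₁† x * Φ.γ₄† x - Φ.γ₁† x * Φ.γ₃ x - Φ.γ₂ x
      * Φ.γ₃† x + Φ.γ₂ x * Φ.γ₄ x := by
  rw [constraint_u₁]
  simp only [map_add, map_sub, map_mul, map_ofNat, h.conj_frameDeriv, ← conjFun_apply,
    conjFun_conjFun, h.conj_γ₂.eq_of_nhds, frameDeriv_congr h.conj_γ₂]

theorem conj_constraint_u₃ (h : SolvesNear lam Φ x) :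
    conj ((𝒞 lam Φ x).2.1 2)
    = ∇[0] Φ Φ.γ₃† x - ∇[0] Φ Φ.γ₄ x + ∇[2] Φ Φ.γ₂ x - Φ.w₃† x + 2 * Φ.γ₃† x * Φ.γ₄† x - 2 * Φ.γ₄†
      x * Φ.γ₄ x + Φ.γ₁† x * Φ.γ₇† x + Φ.γ₂ x * Φ.γ₆ x - Φ.γ₂ x * Φ.γ₈† x - Φ.γ₂ x * Φ.γ₈ x := by
  rw [constraint_u₃]
  simp only [map_add, map_sub, map_mul, map_ofNat, h.conj_frameDeriv, ← conjFun_apply,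
    conjFun_conjFun, h.conj_γ₂.eq_of_nhds, h.conj_γ₆.eq_of_nhds, frameDeriv_congr h.conj_γ₂]

theorem conj_constraint_u₄ (h : SolvesNear lam Φ x) :
    conj ((𝒞 lam Φ x).2.1 3)
    = ∇[1] Φ Φ.γ₄ x - ∇[1] Φ Φ.γ₃† x - ∇[2] Φ Φ.γ₁† x + 3 * Φ.γ₁† x * Φ.γ₈† x + 2 * Φ.γ₃† x *
      Φ.γ₃† x - 2 * Φ.γ₃† x * Φ.γ₄ x - Φ.γ₁† x * Φ.γ₆ x - Φ.γ₁† x * Φ.γ₈ x - Φ.γ₂ x * Φ.γ₇ x := by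
  rw [constraint_u₄]
  simp only [map_add, map_sub, map_mul, map_ofNat, h.conj_frameDeriv, ← conjFun_apply,
    conjFun_conjFun, h.conj_γ₂.eq_of_nhds, h.conj_γ₆.eq_of_nhds]

theorem conj_constraint_u₅ (h : SolvesNear lam Φ x) :
    conj ((𝒞 lam Φ x).2.1 4)
    = ∇[0] Φ Φ.γ₅† x - ∇[3] Φ Φ.γ₇† x - Φ.γ₂ x * Φ.γ₇† x - Φ.γ₄† x * Φ.γ₅† x + Φ.γ₅† x * Φ.γ₅† x -
      Φ.γ₅† x * Φ.γ₃ x - Φ.γ₆ x * Φ.γ₁ x := by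
  rw [constraint_u₅]
  simp only [map_add, map_sub, map_mul, map_ofNat, h.conj_frameDeriv, ← conjFun_apply,
    conjFun_conjFun, h.conj_γ₂.eq_of_nhds, h.conj_γ₆.eq_of_nhds]

theorem conj_constraint_u₆ (h : SolvesNear lam Φ x) :
    conj ((𝒞 lam Φ x).2.1 5)
    = ∇[3] Φ Φ.γ₆ x - ∇[1] Φ Φ.γ₅† x - Φ.w₃† x + Φ.γ₁† x * Φ.γ₇† x + Φ.γ₂ x * Φ.γ₆ x - Φ.γ₃† x *
      Φ.γ₅† x - Φ.γ₅† x * Φ.γ₄ x - Φ.γ₅† x * Φ.γ₅ x := by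
  rw [constraint_u₆]
  simp only [map_add, map_sub, map_mul, map_ofNat, h.conj_frameDeriv, ← conjFun_apply,
    conjFun_conjFun, h.conj_γ₂.eq_of_nhds, h.conj_γ₆.eq_of_nhds, frameDeriv_congr h.conj_γ₆]

theorem conj_constraint_u₇ (h : SolvesNear lam Φ x) :
    conj ((𝒞 lam Φ x).2.1 6)
    = ∇[1] Φ Φ.γ₈† x - ∇[2] Φ Φ.γ₃† x - 2 * Φ.γ₃† x * Φ.γ₆ x + Φ.γ₃† x * Φ.γ₈† x - Φ.γ₃† x * Φ.γ₈
      x + Φ.γ₄† x * Φ.γ₇ x + Φ.γ₆ x * Φ.γ₄ x := by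
  rw [constraint_u₇]
  simp only [map_add, map_sub, map_mul, map_ofNat, h.conj_frameDeriv, ← conjFun_apply,
    conjFun_conjFun, h.conj_γ₆.eq_of_nhds]

theorem conj_constraint_u₈ (h : SolvesNear lam Φ x) :
    conj ((𝒞 lam Φ x).2.1 7)
    = ∇[2] Φ Φ.γ₄† x + ∇[0] Φ Φ.γ₈† x + Φ.w₄† x - 2 * Φ.γ₃† x * Φ.γ₇† x + Φ.γ₄† x * Φ.γ₆ x + Φ.γ₄†
      x * Φ.γ₈† x - Φ.γ₄† x * Φ.γ₈ x + Φ.γ₇† x * Φ.γ₄ x := by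
  rw [constraint_u₈]
  simp only [map_add, map_sub, map_mul, map_ofNat, h.conj_frameDeriv, ← conjFun_apply,
    conjFun_conjFun, h.conj_γ₆.eq_of_nhds]

theorem conj_constraint_u₉ (h : SolvesNear lam Φ x) :
    conj ((𝒞 lam Φ x).2.1 8)
    = ∇[1] Φ Φ.γ₇† x - ∇[0] Φ Φ.γ₆ x - Φ.w₄† x + 3 * Φ.γ₃† x * Φ.γ₇† x + Φ.γ₄† x * Φ.γ₆ x - Φ.γ₆ x
      * Φ.γ₃ x + Φ.γ₇† x * Φ.γ₄ x := by
  rw [constraint_u₉]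
  simp only [map_add, map_sub, map_mul, map_ofNat, h.conj_frameDeriv, ← conjFun_apply,
    conjFun_conjFun, h.conj_γ₆.eq_of_nhds, frameDeriv_congr h.conj_γ₆]

end SolvesNear

/-! ### Commutators of the frame vector fields -/

namespace SolvesNear

variable {lam : Fin 4 → Point → ℝ} {Φ : StateField} {x : Point}

/-- Naming the coefficients `F` and `G` makes their derivatives appear as derivatives of components
of e, in the form in which (SHS) and the definitions of t apply. -/
theorem frameDeriv_comm_expand [hΦ : Fact (ContDiffAt ℝ 2 Φ x)] {f : Point → ℂ}
    (hf : ContDiffAt ℝ 2 f x) (a b : Fin 4) (F G : Fin 4 → Point → ℂ)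
    (hF : ∀ μ, (fun y => frame (Φ y) a μ) = F μ) (hG : ∀ μ, (fun y => frame (Φ y) b μ) = G μ) :
    ∇[a] Φ (∇[b] Φ f) x = ∇[b] Φ (∇[a] Φ f) x
      + ((∇[a] Φ (G 0) x - ∇[b] Φ (F 0) x) * partialDeriv 0 f x
      + (∇[a] Φ (G 1) x - ∇[b] Φ (F 1) x) * partialDeriv 1 f x
      + (∇[a] Φ (G 2) x - ∇[b] Φ (F 2) x) * partialDeriv 2 f x
      + (∇[a] Φ (G 3) x - ∇[b] Φ (F 3) x) * partialDeriv 3 f x) := by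
  rw [frameDeriv_comm hΦ.out hf, Fin.sum_univ_four]
  simp only [hF, hG]

/-- (SHS) gives `L` of e₁ and e₂, hence the ∂₁ and ∂₂ parts. The ∂₃ part is −D(e₃), which is not
governed by (SHS); t₃ is its deviation from the expected value. -/
theorem comm_L_D [hΦ : Fact (ContDiffAt ℝ 2 Φ x)] (h : SolvesNear lam Φ x) {f : Point → ℂ}
    (hf : ContDiffAt ℝ 2 f x) :
    ∇[3] Φ (∇[0] Φ f) x = ∇[0] Φ (∇[3] Φ f) x
      - Φ.γ₂ x * ∇[0] Φ f x - Φ.γ₁ x * ∇[1] Φ f x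
      - (Φ.γ₃ x - Φ.γ₄† x - Φ.γ₅† x) * ∇[3] Φ f x
      - (𝒞 lam Φ x).1 2 * partialDeriv 2 f x := by
  rw [frameDeriv_comm_expand hf 3 0 ![fun _ => 0, fun _ => 0, Φ.e₃, fun _ => 0]
    ![Φ.e₁, Φ.e₂, fun _ => 0, fun _ => 0] (fun μ => by fin_cases μ <;> rfl)
    (fun μ => by fin_cases μ <;> rfl),
    constraint_t₃]
  simp only [Matrix.cons_val, frameDeriv_const, h.e₁_eq.eq_of_nhds, h.e₂_eq.eq_of_nhds,
    frameDeriv_zero Φ f, frameDeriv_one Φ f, frameDeriv_three Φ f]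
  ring

theorem comm_L_Db [hΦ : Fact (ContDiffAt ℝ 2 Φ x)] (h : SolvesNear lam Φ x) {f : Point → ℂ}
    (hf : ContDiffAt ℝ 2 f x) :
    ∇[3] Φ (∇[1] Φ f) x = ∇[1] Φ (∇[3] Φ f) x
      - Φ.γ₂ x * ∇[1] Φ f x - Φ.γ₁† x * ∇[0] Φ f x
      - (Φ.γ₃† x - Φ.γ₄ x - Φ.γ₅ x) * ∇[3] Φ f x
      - conj ((𝒞 lam Φ x).1 2) * partialDeriv 2 f x := by
  rw [frameDeriv_comm_expand hf 3 1 ![fun _ => 0, fun _ => 0, Φ.e₃, fun _ => 0]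
    ![Φ.e₁†, Φ.e₂†, fun _ => 0, fun _ => 0] (fun μ => by fin_cases μ <;> rfl)
    (fun μ => by fin_cases μ <;> rfl), h.conj_constraint_t₃]
  simp only [Matrix.cons_val, frameDeriv_const, h.conj_e₁_eq.eq_of_nhds,
    h.conj_e₂_eq.eq_of_nhds, frameDeriv_zero Φ f, frameDeriv_one Φ f, frameDeriv_three Φ f]
  ring

/-- Here (SHS) gives neither N(e₁) nor D(e₄), so both coordinate components are expressed through
the conjugates of t₄ and t₅. -/
theorem comm_N_D [hΦ : Fact (ContDiffAt ℝ 2 Φ x)] (h : SolvesNear lam Φ x) {f : Point → ℂ}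
    (hf : ContDiffAt ℝ 2 f x) :
    ∇[2] Φ (∇[0] Φ f) x = ∇[0] Φ (∇[2] Φ f) x
      - Φ.γ₇† x * ∇[1] Φ f x
      - (Φ.γ₆ x - Φ.γ₈ x + Φ.γ₈† x) * ∇[0] Φ f x
      - conj ((𝒞 lam Φ x).1 3) * partialDeriv 0 f x
      - conj ((𝒞 lam Φ x).1 4) * partialDeriv 1 f x := by
  rw [frameDeriv_comm_expand hf 2 0 ![Φ.e₄, Φ.e₅, fun _ => 0, fun _ => 1]
    ![Φ.e₁, Φ.e₂, fun _ => 0, fun _ => 0] (fun μ => by fin_cases μ <;> rfl)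
    (fun μ => by fin_cases μ <;> rfl), h.conj_constraint_t₄, h.conj_constraint_t₅]
  simp only [Matrix.cons_val, frameDeriv_const, frameDeriv_zero Φ f, frameDeriv_one Φ f]
  ring

theorem comm_N_Db [hΦ : Fact (ContDiffAt ℝ 2 Φ x)] (h : SolvesNear lam Φ x) {f : Point → ℂ}
    (hf : ContDiffAt ℝ 2 f x) :
    ∇[2] Φ (∇[1] Φ f) x = ∇[1] Φ (∇[2] Φ f) x
      - Φ.γ₇ x * ∇[0] Φ f x
      - (Φ.γ₆ x - Φ.γ₈† x + Φ.γ₈ x) * ∇[1] Φ f x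
      - (𝒞 lam Φ x).1 3 * partialDeriv 0 f x
      - (𝒞 lam Φ x).1 4 * partialDeriv 1 f x := by
  rw [frameDeriv_comm_expand hf 2 1 ![Φ.e₄, Φ.e₅, fun _ => 0, fun _ => 1]
    ![Φ.e₁†, Φ.e₂†, fun _ => 0, fun _ => 0] (fun μ => by fin_cases μ <;> rfl)
    (fun μ => by fin_cases μ <;> rfl),
    constraint_t₄,
    constraint_t₅]
  simp only [Matrix.cons_val, frameDeriv_const, frameDeriv_zero Φ f, frameDeriv_one Φ f]
  ring

/-- All three coefficients N(e₃), L(e₄), L(e₅) are prescribed by (SHS), so this is the one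
commutator without a constraint defect. -/
theorem comm_N_L [hΦ : Fact (ContDiffAt ℝ 2 Φ x)] (h : SolvesNear lam Φ x) {f : Point → ℂ}
    (hf : ContDiffAt ℝ 2 f x) :
    ∇[2] Φ (∇[3] Φ f) x = ∇[3] Φ (∇[2] Φ f) x
      + (Φ.γ₈ x + Φ.γ₈† x) * ∇[3] Φ f x
      - (Φ.γ₃† x - Φ.γ₄ x + Φ.γ₅ x) * ∇[0] Φ f x
      - (Φ.γ₃ x - Φ.γ₄† x + Φ.γ₅† x) * ∇[1] Φ f x := by
  rw [frameDeriv_comm_expand hf 2 3 ![Φ.e₄, Φ.e₅, fun _ => 0, fun _ => 1]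
    ![fun _ => 0, fun _ => 0, Φ.e₃, fun _ => 0] (fun μ => by fin_cases μ <;> rfl)
    (fun μ => by fin_cases μ <;> rfl)]
  simp only [Matrix.cons_val, frameDeriv_const, h.e₃_eq.eq_of_nhds, h.e₄_eq.eq_of_nhds,
    h.e₅_eq.eq_of_nhds, frameDeriv_zero Φ f, frameDeriv_one Φ f, frameDeriv_three Φ f]
  ring

/-- Both orientations serve as rewrite rules: this one where `L` acts on a constraint containing an
`N` derivative, the previous one where `N` acts on an `L` derivative. -/
theorem comm_L_N [hΦ : Fact (ContDiffAt ℝ 2 Φ x)] (h : SolvesNear lam Φ x) {f : Point → ℂ}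
    (hf : ContDiffAt ℝ 2 f x) :
    ∇[3] Φ (∇[2] Φ f) x = ∇[2] Φ (∇[3] Φ f) x
      - (Φ.γ₈ x + Φ.γ₈† x) * ∇[3] Φ f x
      + (Φ.γ₃† x - Φ.γ₄ x + Φ.γ₅ x) * ∇[0] Φ f x
      + (Φ.γ₃ x - Φ.γ₄† x + Φ.γ₅† x) * ∇[1] Φ f x := by
  linear_combination -h.comm_N_L hf

theorem comm_D_Db [hΦ : Fact (ContDiffAt ℝ 2 Φ x)] (h : SolvesNear lam Φ x) {f : Point → ℂ}
    (hf : ContDiffAt ℝ 2 f x) :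
    ∇[0] Φ (∇[1] Φ f) x = ∇[1] Φ (∇[0] Φ f) x
      - (Φ.γ₃ x + Φ.γ₄† x) * ∇[1] Φ f x
      + (Φ.γ₃† x + Φ.γ₄ x) * ∇[0] Φ f x
      - I * (𝒞 lam Φ x).1 0 * partialDeriv 0 f x
      - I * (𝒞 lam Φ x).1 1 * partialDeriv 1 f x := by
  rw [frameDeriv_comm_expand hf 0 1 ![Φ.e₁, Φ.e₂, fun _ => 0, fun _ => 0]
    ![Φ.e₁†, Φ.e₂†, fun _ => 0, fun _ => 0] (fun μ => by fin_cases μ <;> rfl)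
    (fun μ => by fin_cases μ <;> rfl), h.constraint_t₁.eq_of_nhds, h.constraint_t₂.eq_of_nhds]
  simp only [Matrix.cons_val, frameDeriv_const, frameDeriv_zero Φ f, frameDeriv_one Φ f,
    ← mul_assoc, Complex.I_mul_I]
  ring

end SolvesNear

/-! ### Components of the dual system -/

section Components

variable (lam : Fin 4 → Point → ℝ) (Φ : StateField) (x : Point) (ψ : ConstraintVec)

/-- The component formulas are kept for arbitrary ψ: they serve the evaluation on the constraint
field as well as the linearity of the right hand side. -/
theorem hatRHS_t₁ : (hatRHS lam Φ x ψ).1 0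
    = -2 * Φ.γ₂ x * ψ.1 0 + ((2 * (ψ.1 2 * partialDeriv 2 Φ.e₁† x).im : ℝ) : ℂ) + ((2 * (Φ.e₁† x *
      ψ.2.1 0).im : ℝ) : ℂ) := rfl

theorem hatRHS_t₂ : (hatRHS lam Φ x ψ).1 1
    = -2 * Φ.γ₂ x * ψ.1 1 + ((2 * (ψ.1 2 * partialDeriv 2 Φ.e₂† x).im : ℝ) : ℂ) + ((2 * (Φ.e₂† x *
      ψ.2.1 0).im : ℝ) : ℂ) := rfl

theorem hatRHS_t₃ : (hatRHS lam Φ x ψ).1 2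
    = (-Φ.γ₆ x + 2 * Φ.γ₈ x) * ψ.1 2 - Φ.γ₇† x * conj (ψ.1 2) - conj (ψ.1 3) * partialDeriv 0 Φ.e₃
      x - conj (ψ.1 4) * partialDeriv 1 Φ.e₃ x + Φ.e₃ x * ψ.2.1 6 + Φ.e₃ x * conj (ψ.2.1 7) := rfl

theorem hatRHS_t₄ : (hatRHS lam Φ x ψ).1 3
    = I * (Φ.γ₃† x - Φ.γ₄ x + Φ.γ₅ x) * ψ.1 0 - Φ.γ₂ x * ψ.1 3 - Φ.γ₁† x * conj (ψ.1 3) -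
      conj (ψ.1 2) * partialDeriv 2 Φ.e₄ x + Φ.e₁† x * ψ.2.1 2 - Φ.e₁ x * conj (ψ.2.1 3) + Φ.e₁ x *
      ψ.2.1 4 - Φ.e₁† x * conj (ψ.2.1 5) := rfl

theorem hatRHS_t₅ : (hatRHS lam Φ x ψ).1 4
    = I * (Φ.γ₃† x - Φ.γ₄ x + Φ.γ₅ x) * ψ.1 1 - Φ.γ₂ x * ψ.1 4 - Φ.γ₁† x * conj (ψ.1 4) -
      conj (ψ.1 2) * partialDeriv 2 Φ.e₅ x + Φ.e₂† x * ψ.2.1 2 - Φ.e₂ x * conj (ψ.2.1 3) + Φ.e₂ x *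
      ψ.2.1 4 - Φ.e₂† x * conj (ψ.2.1 5) := rfl

theorem hatRHS_u₁ : (hatRHS lam Φ x ψ).2.1 0
    = -ψ.1 2 * partialDeriv 2 Φ.γ₂ x + conj (ψ.1 2) * partialDeriv 2 Φ.γ₁ x - 3 * Φ.γ₂ x * ψ.2.1 0
      + Φ.γ₁ x * conj (ψ.2.1 0) + 1 / (lam 0 x : ℂ) * ψ.2.2 0 := rfl

theorem hatRHS_u₂ : (hatRHS lam Φ x ψ).2.1 1
    = -ψ.1 2 * partialDeriv 2 Φ.γ₄ x - conj (ψ.1 2) * partialDeriv 2 Φ.γ₃ x - Φ.γ₄ x * ψ.2.1 0 +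
      Φ.γ₅ x * ψ.2.1 0 - Φ.γ₃ x * conj (ψ.2.1 0) - 2 * Φ.γ₂ x * ψ.2.1 1 - Φ.γ₁ x * ψ.2.1 4 - Φ.γ₂ x
      * ψ.2.1 5 - 1 / (lam 1 x : ℂ) * ψ.2.2 1 := rfl

theorem hatRHS_u₃ : (hatRHS lam Φ x ψ).2.1 2
    = -conj (ψ.1 2) * partialDeriv 2 Φ.γ₃ x + conj (ψ.1 2) * partialDeriv 2 Φ.γ₄† x + Φ.γ₃† x *
      ψ.2.1 0 - Φ.γ₄ x * ψ.2.1 0 + Φ.γ₅ x * ψ.2.1 0 - 2 * Φ.γ₂ x * ψ.2.1 2 + Φ.γ₁† x * ψ.2.1 3 +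
      Φ.γ₁ x * conj (ψ.2.1 3) - Φ.γ₁ x * ψ.2.1 4 + Φ.γ₂ x * conj (ψ.2.1 5) - 1 / (lam 1 x : ℂ) *
      ψ.2.2 1 := rfl

theorem hatRHS_u₄ : (hatRHS lam Φ x ψ).2.1 3
    = ψ.1 2 * partialDeriv 2 Φ.γ₃ x - ψ.1 2 * partialDeriv 2 Φ.γ₄† x + (Φ.γ₃ x - Φ.γ₄† x + Φ.γ₅†
      x) * ψ.2.1 0 + Φ.γ₁ x * ψ.2.1 2 + Φ.γ₁ x * conj (ψ.2.1 2) - 2 * Φ.γ₂ x * ψ.2.1 3 + Φ.γ₂ x *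
      conj (ψ.2.1 4) - Φ.γ₁ x * ψ.2.1 5 := rfl

theorem hatRHS_u₅ : (hatRHS lam Φ x ψ).2.1 4
    = -ψ.1 3 * partialDeriv 0 Φ.γ₅ x - ψ.1 4 * partialDeriv 1 Φ.γ₅ x - Φ.γ₇ x * ψ.2.1 2 + Φ.γ₆ x *
      conj (ψ.2.1 3) - 2 * Φ.γ₆ x * ψ.2.1 4 - 2 * Φ.γ₈ x * ψ.2.1 4 + 2 * Φ.γ₈† x * ψ.2.1 4 + Φ.γ₇ x
      * ψ.2.1 5 + Φ.γ₇ x * conj (ψ.2.1 5) + Φ.γ₅ x * conj (ψ.2.1 6) - Φ.γ₅ x * ψ.2.1 7 - Φ.γ₄ x *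
      ψ.2.1 8 + Φ.γ₅ x * ψ.2.1 8 + Φ.γ₃† x * ψ.2.1 8 := rfl

theorem hatRHS_u₆ : (hatRHS lam Φ x ψ).2.1 5
    = conj (ψ.1 3) * partialDeriv 0 Φ.γ₅ x + conj (ψ.1 4) * partialDeriv 1 Φ.γ₅ x + Φ.γ₆ x * conj
      (ψ.2.1 2) - Φ.γ₇ x * ψ.2.1 3 + Φ.γ₇† x * ψ.2.1 4 + Φ.γ₇ x * conj (ψ.2.1 4) - 2 * Φ.γ₆ x *
      ψ.2.1 5 + Φ.γ₅ x * ψ.2.1 6 - Φ.γ₅ x * conj (ψ.2.1 7) + Φ.γ₃ x * ψ.2.1 8 - Φ.γ₄† x * ψ.2.1 8 +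
      Φ.γ₅† x * ψ.2.1 8 + 1 / (lam 2 x : ℂ) * ψ.2.2 1 := rfl

theorem hatRHS_u₇ : (hatRHS lam Φ x ψ).2.1 6
    = -ψ.1 2 * partialDeriv 2 Φ.γ₈ x - Φ.γ₃ x * ψ.2.1 1 + Φ.γ₄† x * ψ.2.1 1 - Φ.γ₅† x * ψ.2.1 1 +
      Φ.γ₃ x * conj (ψ.2.1 2) + Φ.γ₄ x * ψ.2.1 3 - Φ.γ₅ x * ψ.2.1 3 - Φ.γ₄ x * conj (ψ.2.1 4) - 2 *
      Φ.γ₃ x * ψ.2.1 5 + Φ.γ₄† x * ψ.2.1 5 - Φ.γ₂ x * ψ.2.1 6 - Φ.γ₁ x * ψ.2.1 7 - 1 / (lam 1 x : ℂ)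
      * ψ.2.2 0 := rfl

theorem hatRHS_u₈ : (hatRHS lam Φ x ψ).2.1 7
    = -conj (ψ.1 2) * partialDeriv 2 Φ.γ₈ x + Φ.γ₃† x * ψ.2.1 1 - Φ.γ₄ x * ψ.2.1 1 + Φ.γ₅ x *
      ψ.2.1 1 - Φ.γ₄ x * ψ.2.1 2 + Φ.γ₅ x * ψ.2.1 2 - Φ.γ₃ x * conj (ψ.2.1 3) + 2 * Φ.γ₃ x * ψ.2.1 4
      - Φ.γ₄† x * ψ.2.1 4 + Φ.γ₄ x * conj (ψ.2.1 5) - Φ.γ₁† x * ψ.2.1 6 - Φ.γ₂ x * ψ.2.1 7 + 1 /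
      (lam 2 x : ℂ) * ψ.2.2 2 := rfl

theorem hatRHS_u₉ : (hatRHS lam Φ x ψ).2.1 8
    = ψ.1 3 * partialDeriv 0 Φ.γ₆ x - conj (ψ.1 3) * partialDeriv 0 Φ.γ₇ x + ψ.1 4 * partialDeriv
      1 Φ.γ₆ x - conj (ψ.1 4) * partialDeriv 1 Φ.γ₇ x - 3 * Φ.γ₇ x * ψ.2.1 6 + Φ.γ₆ x * conj (ψ.2.1
      6) + Φ.γ₆ x * ψ.2.1 7 + Φ.γ₇ x * conj (ψ.2.1 7) - 3 * Φ.γ₆ x * ψ.2.1 8 - 2 * Φ.γ₈ x * ψ.2.1 8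
      + Φ.γ₇ x * conj (ψ.2.1 8) + 1 / (lam 3 x : ℂ) * ψ.2.2 2 := rfl

theorem hatRHS_v₁ : (hatRHS lam Φ x ψ).2.2 0
    = -I * ψ.1 0 * partialDeriv 0 Φ.w₂ x - I * ψ.1 1 * partialDeriv 1 Φ.w₂ x + ψ.1
      2 * partialDeriv 2 Φ.w₃ x - ψ.1 3 * partialDeriv 0 Φ.w₁ x - ψ.1 4 * partialDeriv 1 Φ.w₁ x + 3
      * Φ.w₃ x * ψ.2.1 0 + 2 * Φ.w₂ x * ψ.2.1 1 + 4 * Φ.w₂ x * ψ.2.1 2 - 2 * Φ.w₂ x * ψ.2.1 5 + 4 *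
      Φ.w₁ x * ψ.2.1 7 + Φ.w₁ x * ψ.2.1 8 + (-4 / (lam 1 x : ℂ) * Φ.γ₂ x - 2 / (lam 0 x : ℂ) * Φ.γ₆
      x + 3 / (lam 0 x : ℂ) * Φ.γ₈ x + 1 / (lam 0 x : ℂ) * Φ.γ₈† x + (1 / (lam 0 x : ℂ)) ^ 2 * ∇[2]
      Φ (weightC lam 0) x + (1 / (lam 1 x : ℂ)) ^ 2 * ∇[3] Φ (weightC lam 1) x) * ψ.2.2 0 + ((1 /
      (lam 1 x : ℂ)) ^ 2 * ∇[0] Φ (weightC lam 1) x + 4 / (lam 1 x : ℂ) * Φ.γ₃ x - 4 / (lam 1 x : ℂ)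
      * Φ.γ₄† x - 1 / (lam 1 x : ℂ) * Φ.γ₅† x) * ψ.2.2 1 - 2 / (lam 2 x : ℂ) * Φ.γ₁ x * ψ.2.2 2 :=
          rfl

theorem hatRHS_v₂ : (hatRHS lam Φ x ψ).2.2 1
    = -I * ψ.1 0 * partialDeriv 0 Φ.w₃ x - I * ψ.1 1 * partialDeriv 1 Φ.w₃ x + ψ.1
      2 * partialDeriv 2 Φ.w₄ x - ψ.1 3 * partialDeriv 0 Φ.w₂ x - ψ.1 4 * partialDeriv 1 Φ.w₂ x + 2
      * Φ.w₄ x * ψ.2.1 0 + 3 * Φ.w₃ x * ψ.2.1 2 - 3 * Φ.w₃ x * ψ.2.1 5 + 2 * Φ.w₂ x * ψ.2.1 7 + 2 *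
      Φ.w₂ x * ψ.2.1 8 + (-2 / (lam 1 x : ℂ) * Φ.γ₄ x - 2 / (lam 1 x : ℂ) * Φ.γ₅ x + (1 / (lam 1 x :
      ℂ)) ^ 2 * ∇[1] Φ (weightC lam 1) x) * ψ.2.2 0 + (-3 / (lam 2 x : ℂ) * Φ.γ₂ x - 3 / (lam 1 x :
      ℂ) * Φ.γ₆ x + 1 / (lam 1 x : ℂ) * Φ.γ₈ x + 1 / (lam 1 x : ℂ) * Φ.γ₈† x + (1 / (lam 1 x : ℂ)) ^
      2 * ∇[2] Φ (weightC lam 1) x + (1 / (lam 2 x : ℂ)) ^ 2 * ∇[3] Φ (weightC lam 2) x) * ψ.2.2 1 +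
      (1 / (lam 2 x : ℂ) * Φ.γ₃ x - 3 / (lam 2 x : ℂ) * Φ.γ₄† x - 1 / (lam 2 x : ℂ) * Φ.γ₅† x + (1 /
      (lam 2 x : ℂ)) ^ 2 * ∇[0] Φ (weightC lam 2) x) * ψ.2.2 2 := rfl

theorem hatRHS_v₃ : (hatRHS lam Φ x ψ).2.2 2
    = -I * ψ.1 0 * partialDeriv 0 Φ.w₄ x - I * ψ.1 1 * partialDeriv 1 Φ.w₄ x + ψ.1
      2 * partialDeriv 2 Φ.w₅ x - ψ.1 3 * partialDeriv 0 Φ.w₃ x - ψ.1 4 * partialDeriv 1 Φ.w₃ x +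
      Φ.w₅ x * ψ.2.1 0 - 2 * Φ.w₄ x * ψ.2.1 1 + 2 * Φ.w₄ x * ψ.2.1 2 - 4 * Φ.w₄ x * ψ.2.1 5 + 3 *
      Φ.w₃ x * ψ.2.1 8 - 2 / (lam 1 x : ℂ) * Φ.γ₇ x * ψ.2.2 0 + (-3 / (lam 2 x : ℂ) * Φ.γ₅ x + (1 /
      (lam 2 x : ℂ)) ^ 2 * ∇[1] Φ (weightC lam 2) x) * ψ.2.2 1 + (-2 / (lam 3 x : ℂ) * Φ.γ₂ x - 4 /
      (lam 2 x : ℂ) * Φ.γ₆ x - 1 / (lam 2 x : ℂ) * Φ.γ₈ x + 1 / (lam 2 x : ℂ) * Φ.γ₈† x + (1 / (lam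
      2 x : ℂ)) ^ 2 * ∇[2] Φ (weightC lam 2) x + (1 / (lam 3 x : ℂ)) ^ 2 * ∇[3] Φ (weightC lam 3) x)
      * ψ.2.2 2 := rfl

end Components

theorem ofReal_two_mul_im (z : ℂ) : ((2 * z.im : ℝ) : ℂ) = -I * (z - conj z) := by
  rw [Complex.sub_conj]
  push_cast
  linear_combination 2 * (z.im : ℂ) * Complex.I_mul_I

theorem matrixOp_coeffHat₁ (Φ : StateField) (ψ : Point → Fin 5 → ℂ) (x : Point) (i : Fin 5) :
    matrixOp (coeffHat₁ (Φ x)) ψ x i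
      = frameDeriv (![3, 3, 2, 3, 3] i) Φ (fun y => ψ y i) x := by
  simp only [matrixOp, coeffHat₁, Matrix.mulVec_diagonal, Finset.sum_apply, frameDeriv]
  fin_cases i <;> rfl

theorem matrixOp_coeffHat₂ (Φ : StateField) (ψ : Point → Fin 9 → ℂ) (x : Point) (i : Fin 9) :
    matrixOp (coeffHat₂ (Φ x)) ψ x i
      = frameDeriv (![3, 3, 3, 3, 2, 2, 3, 3, 2] i) Φ (fun y => ψ y i) x := by
  simp only [matrixOp, coeffHat₂, Matrix.mulVec_diagonal, Finset.sum_apply, frameDeriv]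
  fin_cases i <;> rfl

theorem matrixOp_coeffHat₃ (l : Fin 4 → ℝ) (Φ : StateField) (ψ : Point → Fin 3 → ℂ) (x : Point) :
    matrixOp (coeffHat₃ l (Φ x)) ψ x = ![
      1 / l 0 * ∇[2] Φ (fun y => ψ y 0) x + 1 / l 1 * ∇[3] Φ (fun y => ψ y 0) x
        + 1 / l 1 * ∇[0] Φ (fun y => ψ y 1) x,
      1 / l 1 * ∇[1] Φ (fun y => ψ y 0) x + 1 / l 1 * ∇[2] Φ (fun y => ψ y 1) x
        + 1 / l 2 * ∇[3] Φ (fun y => ψ y 1) x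
        + 1 / l 2 * ∇[0] Φ (fun y => ψ y 2) x,
      1 / l 2 * ∇[1] Φ (fun y => ψ y 1) x + 1 / l 2 * ∇[2] Φ (fun y => ψ y 2) x
        + 1 / l 3 * ∇[3] Φ (fun y => ψ y 2) x] := by
  ext i
  simp only [matrixOp, Finset.sum_apply, Matrix.mulVec, dotProduct, frameDeriv, Finset.mul_sum,
    ← Finset.sum_add_distrib]
  fin_cases i <;> simp only [coeffHat₃, Fin.sum_univ_three] <;>
    simp [← Finset.sum_add_distrib, Finset.mul_sum] <;>
    refine Finset.sum_congr rfl fun μ _ => ?_ <;> ring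

theorem matrixOp_coeffA₃ (l : Fin 4 → ℝ) (Φ : StateField) (ψ : Point → Fin 5 → ℂ) (x : Point) :
    matrixOp (coeffA₃ l (Φ x)) ψ x = ![
      l 0 * (∇[2] Φ (fun y => ψ y 0) x + ∇[0] Φ (fun y => ψ y 1) x),
      l 0 * (∇[1] Φ (fun y => ψ y 0) x + ∇[3] Φ (fun y => ψ y 1) x)
        + l 1 * (∇[2] Φ (fun y => ψ y 1) x + ∇[0] Φ (fun y => ψ y 2) x),
      l 1 * (∇[1] Φ (fun y => ψ y 1) x + ∇[3] Φ (fun y => ψ y 2) x)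
        + l 2 * (∇[2] Φ (fun y => ψ y 2) x + ∇[0] Φ (fun y => ψ y 3) x),
      l 2 * (∇[1] Φ (fun y => ψ y 2) x + ∇[3] Φ (fun y => ψ y 3) x)
        + l 3 * (∇[2] Φ (fun y => ψ y 3) x + ∇[0] Φ (fun y => ψ y 4) x),
      l 3 * (∇[1] Φ (fun y => ψ y 3) x + ∇[3] Φ (fun y => ψ y 4) x)] := by
  ext i
  simp only [matrixOp, Finset.sum_apply, Matrix.mulVec, dotProduct, frameDeriv, Finset.mul_sum,
    ← Finset.sum_add_distrib]
  fin_cases i <;> simp only [coeffA₃, Fin.sum_univ_five] <;>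
    simp [← Finset.sum_add_distrib, Finset.mul_sum] <;>
    refine Finset.sum_congr rfl fun μ _ => ?_ <;> ring

/-! ### The equations for `w` -/

theorem StateField.w_eta (Φ : StateField) : (fun y => (Φ y).2.2 0) = Φ.w₁ ∧
    (fun y => (Φ y).2.2 1) = Φ.w₂ ∧ (fun y => (Φ y).2.2 2) = Φ.w₃ ∧
    (fun y => (Φ y).2.2 3) = Φ.w₄ ∧ (fun y => (Φ y).2.2 4) = Φ.w₅ := ⟨rfl, rfl, rfl, rfl, rfl⟩

section Bianchi

variable (Φ : StateField)

/-- The first half of the equation number 2 for `w`. -/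
noncomputable def bianchi₁ : Point → ℂ := fun y =>
  ∇[1] Φ Φ.w₁ y + ∇[3] Φ Φ.w₂ y + 4 * Φ.γ₂ y * Φ.w₂ y + 4 * Φ.γ₄ y * Φ.w₁ y + Φ.γ₅ y
    * Φ.w₁ y

/-- The first half of the equation number 3 for `w`. -/
noncomputable def bianchi₂ : Point → ℂ := fun y =>
  ∇[1] Φ Φ.w₂ y + ∇[3] Φ Φ.w₃ y + 3 * Φ.γ₂ y * Φ.w₃ y + 2 * Φ.γ₄ y * Φ.w₂ y + 2 *
    Φ.γ₅ y * Φ.w₂ y + Φ.γ₇ y * Φ.w₁ y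

/-- The first half of the equation number 4 for `w`. -/
noncomputable def bianchi₃ : Point → ℂ := fun y =>
  ∇[1] Φ Φ.w₃ y + ∇[3] Φ Φ.w₄ y + 2 * Φ.γ₂ y * Φ.w₄ y + 3 * Φ.γ₅ y * Φ.w₃ y + 2 *
    Φ.γ₇ y * Φ.w₂ y

/-- The second half of the equation number 2 for `w`. -/
noncomputable def dualBianchi₂ : Point → ℂ := fun y =>
  ∇[2] Φ Φ.w₂ y + ∇[0] Φ Φ.w₃ y + 2 * Φ.γ₁ y * Φ.w₄ y - 3 * Φ.γ₃ y * Φ.w₃ y + 2 *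
    Φ.γ₆ y * Φ.w₂ y - 2 * Φ.γ₈ y * Φ.w₂ y + 3 * Φ.γ₄† y * Φ.w₃ y

/-- The second half of the equation number 3 for `w`. -/
noncomputable def dualBianchi₃ : Point → ℂ := fun y =>
  ∇[2] Φ Φ.w₃ y + ∇[0] Φ Φ.w₄ y + Φ.γ₁ y * Φ.w₅ y + 3 * Φ.γ₆ y * Φ.w₃ y + 2 *
    Φ.γ₄† y * Φ.w₄ y

/-- The second half of the equation number 4 for `w`. -/
noncomputable def dualBianchi₄ : Point → ℂ := fun y =>
  ∇[2] Φ Φ.w₄ y + ∇[0] Φ Φ.w₅ y + 3 * Φ.γ₃ y * Φ.w₅ y + 4 * Φ.γ₆ y * Φ.w₄ y + 2 *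
    Φ.γ₈ y * Φ.w₄ y + Φ.γ₄† y * Φ.w₅ y

end Bianchi

namespace SolvesNear

variable {lam : Fin 4 → Point → ℝ} {Φ : StateField} {x : Point}

/-- The first and the last row of `A₃` carry a single weight, which cancels. They yield genuine
equations for N(w₁) and L(w₅), whereas a middle row only relates its two halves. -/
theorem w₁_eq (h : SolvesNear lam Φ x) :
    ∇[2] Φ Φ.w₁ =ᶠ[nhds x] fun y =>
      -∇[0] Φ Φ.w₂ y - (3 * Φ.γ₁ y * Φ.w₃ y - 6 * Φ.γ₃ y * Φ.w₂ y + Φ.γ₆ y * Φ.w₁ y - 4 *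
          Φ.γ₈ y
      * Φ.w₁ y + 4 * Φ.γ₄† y * Φ.w₂ y) := by
  filter_upwards [h.equation, h.lam_pos] with y hy hl
  have hy := congrFun (congrArg (fun p => p.2.2) hy) 0
  have hl : (lam 0 y : ℂ) ≠ 0 := by exact_mod_cast (hl 0).ne'
  simp only [shsLHS, matrixOp_coeffA₃, shsRHS, Matrix.cons_val, StateField.w_eta] at hy
  refine mul_left_cancel₀ hl ?_
  simp only [StateField.γ₁, StateField.γ₂, StateField.γ₃, StateField.γ₄,
    StateField.γ₅, StateField.γ₆, StateField.γ₇, StateField.γ₈, StateField.w₁, StateField.w₂,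
    StateField.w₃, StateField.w₄, StateField.w₅, conjFun]
  linear_combination hy

theorem w₅_eq (h : SolvesNear lam Φ x) :
    ∇[3] Φ Φ.w₅ =ᶠ[nhds x] fun y =>
      -∇[1] Φ Φ.w₄ y - (Φ.γ₂ y * Φ.w₅ y - 2 * Φ.γ₄ y * Φ.w₄ y + 4 * Φ.γ₅ y * Φ.w₄ y + 3 *
          Φ.γ₇ y
      * Φ.w₃ y) := by
  filter_upwards [h.equation, h.lam_pos] with y hy hl
  have hy := congrFun (congrArg (fun p => p.2.2) hy) 4
  have hl : (lam 3 y : ℂ) ≠ 0 := by exact_mod_cast (hl 3).ne'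
  simp only [shsLHS, matrixOp_coeffA₃, shsRHS, Matrix.cons_val, StateField.w_eta] at hy
  refine mul_left_cancel₀ hl ?_
  simp only [StateField.γ₁, StateField.γ₂, StateField.γ₃, StateField.γ₄,
    StateField.γ₅, StateField.γ₆, StateField.γ₇, StateField.γ₈, StateField.w₁, StateField.w₂,
    StateField.w₃, StateField.w₄, StateField.w₅, conjFun]
  linear_combination hy

/-- The second row of the w-system says that its two weighted halves add up to zero. Thus v₁,
defined by the half with weight λ₁, is also minus the half with weight λ₂; v₂ and v₃ are treated
likewise. -/
theorem constraint_v₁_eq' (h : SolvesNear lam Φ x) :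
    (fun y => (𝒞 lam Φ y).2.2 0)
      =ᶠ[nhds x] fun y => weightC lam 1 y * -dualBianchi₂ Φ y := by
  filter_upwards [h.equation] with y hy
  have hy := congrFun (congrArg (fun p => p.2.2) hy) 1
  simp only [shsLHS, matrixOp_coeffA₃, shsRHS, Matrix.cons_val, StateField.w_eta] at hy
  refine (constraint_v₁ lam Φ y).trans ?_
  simp only [dualBianchi₂, weightC, StateField.γ₁, StateField.γ₂, StateField.γ₃, StateField.γ₄,
    StateField.γ₅, StateField.γ₆, StateField.γ₇, StateField.γ₈, StateField.w₁, StateField.w₂,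
    StateField.w₃, StateField.w₄, StateField.w₅, conjFun]
  linear_combination hy

theorem constraint_v₂_eq' (h : SolvesNear lam Φ x) :
    (fun y => (𝒞 lam Φ y).2.2 1)
      =ᶠ[nhds x] fun y => weightC lam 2 y * -dualBianchi₃ Φ y := by
  filter_upwards [h.equation] with y hy
  have hy := congrFun (congrArg (fun p => p.2.2) hy) 2
  simp only [shsLHS, matrixOp_coeffA₃, shsRHS, Matrix.cons_val, StateField.w_eta] at hy
  refine (constraint_v₂ lam Φ y).trans ?_
  simp only [dualBianchi₃, weightC, StateField.γ₁, StateField.γ₂, StateField.γ₃, StateField.γ₄,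
    StateField.γ₅, StateField.γ₆, StateField.γ₇, StateField.γ₈, StateField.w₁, StateField.w₂,
    StateField.w₃, StateField.w₄, StateField.w₅, conjFun]
  linear_combination hy

theorem constraint_v₃_eq' (h : SolvesNear lam Φ x) :
    (fun y => (𝒞 lam Φ y).2.2 2)
      =ᶠ[nhds x] fun y => weightC lam 3 y * -dualBianchi₄ Φ y := by
  filter_upwards [h.equation] with y hy
  have hy := congrFun (congrArg (fun p => p.2.2) hy) 3
  simp only [shsLHS, matrixOp_coeffA₃, shsRHS, Matrix.cons_val, StateField.w_eta] at hy
  refine (constraint_v₃ lam Φ y).trans ?_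
  simp only [dualBianchi₄, weightC, StateField.γ₁, StateField.γ₂, StateField.γ₃, StateField.γ₄,
    StateField.γ₅, StateField.γ₆, StateField.γ₇, StateField.γ₈, StateField.w₁, StateField.w₂,
    StateField.w₃, StateField.w₄, StateField.w₅, conjFun]
  linear_combination hy

theorem contDiffAt_weightC (h : SolvesNear lam Φ x) (i : Fin 4) :
    ContDiffAt ℝ 1 (weightC lam i) x :=
  Complex.ofRealCLM.contDiff.contDiffAt.comp x (h.contDiffAt_lam i)

theorem one_div_mul_eq (h : SolvesNear lam Φ x) {i : Fin 4} {V B : Point → ℂ}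
    (hV : V =ᶠ[nhds x] fun y => weightC lam i y * B y) : 1 / (lam i x : ℂ) * V x = B x := by
  have hl : (lam i x : ℂ) ≠ 0 := by exact_mod_cast (h.lam_pos.self_of_nhds i).ne'
  rw [hV.eq_of_nhds, weightC, ← mul_assoc, one_div_mul_cancel hl, one_mul]

/-- This is the source of the terms with squared inverse weights in the dual system: the product
rule leaves λ⁻¹·F(λ)·B, and B = λ⁻¹·V. It needs the weight dividing `V` to be the one in its
representation. -/
theorem one_div_mul_frameDeriv (h : SolvesNear lam Φ x) {i : Fin 4} {V B : Point → ℂ}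
    (hV : V =ᶠ[nhds x] fun y => weightC lam i y * B y) (hB : DifferentiableAt ℝ B x)
    (a : Fin 4) : 1 / (lam i x : ℂ) * ∇[a] Φ V x
      = ∇[a] Φ B x + (1 / (lam i x : ℂ)) ^ 2 * ∇[a] Φ (weightC lam i) x * V x := by
  have hl : (lam i x : ℂ) ≠ 0 := by exact_mod_cast (h.lam_pos.self_of_nhds i).ne'
  rw [frameDeriv_congr hV, frameDeriv_mul ((h.contDiffAt_weightC i).differentiableAt one_ne_zero)
      hB,
    hV.eq_of_nhds, weightC]
  field_simp

theorem constraint_v₁_eq (lam : Fin 4 → Point → ℝ) (Φ : StateField) (x : Point) :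
    (fun y => (𝒞 lam Φ y).2.2 0)
      =ᶠ[nhds x] fun y => weightC lam 0 y * bianchi₁ Φ y := .of_eq rfl

theorem constraint_v₂_eq (lam : Fin 4 → Point → ℝ) (Φ : StateField) (x : Point) :
    (fun y => (𝒞 lam Φ y).2.2 1)
      =ᶠ[nhds x] fun y => weightC lam 1 y * bianchi₂ Φ y := .of_eq rfl

theorem constraint_v₃_eq (lam : Fin 4 → Point → ℝ) (Φ : StateField) (x : Point) :
    (fun y => (𝒞 lam Φ y).2.2 2)
      =ᶠ[nhds x] fun y => weightC lam 2 y * bianchi₃ Φ y := .of_eq rfl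

end SolvesNear

end DualSystem

/-! ### The equations of the dual system, component by component -/

namespace DualSystem.SolvesNear

variable {lam : Fin 4 → Point → ℝ} {Φ : StateField} {x : Point}

/-- The pattern for all components of t and u. After commuting, `L` acts on γ₁ and γ₂ inside `D̄`
and `D`, where (SHS) is used as an identity of germs. The terms D̄(w₁) and L(w₂) that appear form
`bianchi₁`, that is v₁/λ₁. Commutator defects stay unexpanded and match the t terms on the right. -/
theorem dual_u₁ (h : SolvesNear lam Φ x) :
    ∇[3] Φ (fun y => (𝒞 lam Φ y).2.1 0) x
      = (hatRHS lam Φ x (𝒞 lam Φ x)).2.1 0 := by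
  have := h.fact
  simp only [hatRHS_u₁, h.conj_constraint_u₁, h.one_div_mul_eq (constraint_v₁_eq lam Φ x), bianchi₁]
  simp (disch := fun_prop) only [constraint_u₁, frameDeriv_add, frameDeriv_sub, frameDeriv_mul,
    frameDeriv_neg, frameDeriv_const, h.comm_L_D, h.comm_L_Db, frameDeriv_congr h.γ₁_eq,
    frameDeriv_congr h.γ₂_eq, h.γ₁_eq.eq_of_nhds, h.γ₂_eq.eq_of_nhds, h.γ₃_eq.eq_of_nhds,
    h.conj_γ₃_eq.eq_of_nhds, h.γ₄_eq.eq_of_nhds, h.conj_γ₄_eq.eq_of_nhds]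
  ring

theorem dual_u₂ (h : SolvesNear lam Φ x) :
    ∇[3] Φ (fun y => (𝒞 lam Φ y).2.1 1) x
      = (hatRHS lam Φ x (𝒞 lam Φ x)).2.1 1 := by
  have := h.fact
  simp only [hatRHS_u₂, h.conj_constraint_u₁, h.one_div_mul_eq (constraint_v₂_eq lam Φ x), bianchi₂]
  simp (disch := fun_prop) only [constraint_u₁, constraint_u₂, constraint_u₅, constraint_u₆,
    frameDeriv_add, frameDeriv_sub, frameDeriv_mul, frameDeriv_neg, frameDeriv_const, h.comm_L_D,
    h.comm_L_Db, frameDeriv_congr h.γ₃_eq, frameDeriv_congr h.γ₄_eq, h.γ₁_eq.eq_of_nhds,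
    h.γ₂_eq.eq_of_nhds, h.γ₃_eq.eq_of_nhds, h.conj_γ₃_eq.eq_of_nhds, h.γ₄_eq.eq_of_nhds,
    h.conj_γ₄_eq.eq_of_nhds]
  ring

theorem dual_u₃ (h : SolvesNear lam Φ x) :
    ∇[3] Φ (fun y => (𝒞 lam Φ y).2.1 2) x
      = (hatRHS lam Φ x (𝒞 lam Φ x)).2.1 2 := by
  have := h.fact
  simp only [hatRHS_u₃, h.conj_constraint_u₄, h.conj_constraint_u₆, h.one_div_mul_eq
    (constraint_v₂_eq lam Φ x), bianchi₂]
  simp (disch := fun_prop) only [constraint_u₁, constraint_u₃, constraint_u₄, constraint_u₅,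
    frameDeriv_add, frameDeriv_sub, frameDeriv_mul, frameDeriv_neg, frameDeriv_const, h.comm_L_Db,
    h.comm_L_N, frameDeriv_congr h.γ₂_eq, frameDeriv_congr h.γ₃_eq, frameDeriv_congr h.conj_γ₄_eq,
    h.γ₁_eq.eq_of_nhds, h.γ₂_eq.eq_of_nhds, h.γ₃_eq.eq_of_nhds, h.γ₄_eq.eq_of_nhds,
    h.conj_γ₄_eq.eq_of_nhds, h.γ₈_eq.eq_of_nhds, h.conj_γ₈_eq.eq_of_nhds]
  ring

/-- The derivatives of w arising here, N(w₁) and D(w₂), form the first row of the w-system, so no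
component of v enters. -/
theorem dual_u₄ (h : SolvesNear lam Φ x) :
    ∇[3] Φ (fun y => (𝒞 lam Φ y).2.1 3) x
      = (hatRHS lam Φ x (𝒞 lam Φ x)).2.1 3 := by
  have := h.fact
  simp only [hatRHS_u₄, h.conj_constraint_u₃, h.conj_constraint_u₅]
  simp (disch := fun_prop) only [constraint_u₁, constraint_u₃, constraint_u₄, constraint_u₆,
    frameDeriv_add, frameDeriv_sub, frameDeriv_mul, frameDeriv_neg, frameDeriv_const, h.comm_L_D,
    h.comm_L_N, frameDeriv_congr h.γ₁_eq, frameDeriv_congr h.γ₃_eq, frameDeriv_congr h.conj_γ₄_eq,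
    h.γ₁_eq.eq_of_nhds, h.γ₂_eq.eq_of_nhds, h.γ₃_eq.eq_of_nhds, h.conj_γ₄_eq.eq_of_nhds,
    h.γ₈_eq.eq_of_nhds, h.conj_γ₈_eq.eq_of_nhds, h.w₁_eq.eq_of_nhds]
  ring

/-- Now D̄(w₄) and L(w₅) arise; they form the last row of the w-system, and again v is absent. -/
theorem dual_u₅ (h : SolvesNear lam Φ x) :
    ∇[2] Φ (fun y => (𝒞 lam Φ y).2.1 4) x
      = (hatRHS lam Φ x (𝒞 lam Φ x)).2.1 4 := by
  have := h.fact
  simp only [hatRHS_u₅, h.conj_constraint_u₄, h.conj_constraint_u₆, h.conj_constraint_u₇]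
  simp (disch := fun_prop) only [constraint_u₃, constraint_u₅, constraint_u₆, constraint_u₈,
    constraint_u₉, frameDeriv_add, frameDeriv_sub, frameDeriv_mul, frameDeriv_neg,
    frameDeriv_const, h.comm_N_Db, h.comm_N_L, frameDeriv_congr h.γ₅_eq, frameDeriv_congr h.γ₇_eq,
    h.γ₅_eq.eq_of_nhds, h.γ₆_eq.eq_of_nhds, h.γ₇_eq.eq_of_nhds, h.γ₈_eq.eq_of_nhds,
    h.conj_γ₈_eq.eq_of_nhds, h.w₅_eq.eq_of_nhds]
  ring

/-- Commuting produces N(w₃) and D(w₄), the other half of the third row. This is why v₂ enters with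
1/λ₃ here but with 1/λ₂ in the equations for u₂ and u₃. -/
theorem dual_u₆ (h : SolvesNear lam Φ x) :
    ∇[2] Φ (fun y => (𝒞 lam Φ y).2.1 5) x
      = (hatRHS lam Φ x (𝒞 lam Φ x)).2.1 5 := by
  have := h.fact
  simp only [hatRHS_u₆, h.conj_constraint_u₃, h.conj_constraint_u₅, h.conj_constraint_u₈,
    h.one_div_mul_eq h.constraint_v₂_eq', dualBianchi₃]
  simp (disch := fun_prop) only [constraint_u₄, constraint_u₅, constraint_u₆, constraint_u₇,
    constraint_u₉, frameDeriv_add, frameDeriv_sub, frameDeriv_mul, frameDeriv_neg, h.comm_N_D,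
    h.comm_N_L, frameDeriv_congr h.γ₅_eq, frameDeriv_congr h.γ₆_eq, h.γ₅_eq.eq_of_nhds,
    h.conj_γ₅_eq.eq_of_nhds, h.γ₆_eq.eq_of_nhds, h.γ₇_eq.eq_of_nhds, h.γ₈_eq.eq_of_nhds,
    h.conj_γ₈_eq.eq_of_nhds]
  ring

theorem dual_u₇ (h : SolvesNear lam Φ x) :
    ∇[3] Φ (fun y => (𝒞 lam Φ y).2.1 6) x
      = (hatRHS lam Φ x (𝒞 lam Φ x)).2.1 6 := by
  have := h.fact
  simp only [hatRHS_u₇, h.conj_constraint_u₃, h.conj_constraint_u₅, h.one_div_mul_eq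
    h.constraint_v₁_eq', dualBianchi₂]
  simp (disch := fun_prop) only [constraint_u₂, constraint_u₄, constraint_u₆, constraint_u₇,
    constraint_u₈, frameDeriv_add, frameDeriv_sub, frameDeriv_mul, frameDeriv_neg,
    frameDeriv_const, h.comm_L_D, h.comm_L_N, frameDeriv_congr h.γ₃_eq, frameDeriv_congr h.γ₈_eq,
    h.γ₃_eq.eq_of_nhds, h.γ₄_eq.eq_of_nhds, h.conj_γ₄_eq.eq_of_nhds, h.γ₅_eq.eq_of_nhds,
    h.γ₈_eq.eq_of_nhds, h.conj_γ₈_eq.eq_of_nhds]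
  ring

theorem dual_u₈ (h : SolvesNear lam Φ x) :
    ∇[3] Φ (fun y => (𝒞 lam Φ y).2.1 7) x
      = (hatRHS lam Φ x (𝒞 lam Φ x)).2.1 7 := by
  have := h.fact
  simp only [hatRHS_u₈, h.conj_constraint_u₄, h.conj_constraint_u₆, h.one_div_mul_eq
    (constraint_v₃_eq lam Φ x), bianchi₃]
  simp (disch := fun_prop) only [constraint_u₂, constraint_u₃, constraint_u₅, constraint_u₇,
    constraint_u₈, frameDeriv_add, frameDeriv_sub, frameDeriv_mul, frameDeriv_neg,
    frameDeriv_const, h.comm_L_Db, h.comm_L_N, frameDeriv_congr h.γ₄_eq, frameDeriv_congr h.γ₈_eq,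
    h.γ₃_eq.eq_of_nhds, h.γ₄_eq.eq_of_nhds, h.conj_γ₄_eq.eq_of_nhds, h.γ₅_eq.eq_of_nhds,
    h.γ₈_eq.eq_of_nhds, h.conj_γ₈_eq.eq_of_nhds]
  ring

theorem dual_u₉ (h : SolvesNear lam Φ x) :
    ∇[2] Φ (fun y => (𝒞 lam Φ y).2.1 8) x
      = (hatRHS lam Φ x (𝒞 lam Φ x)).2.1 8 := by
  have := h.fact
  simp only [hatRHS_u₉, h.conj_constraint_u₇, h.conj_constraint_u₈, h.conj_constraint_u₉,
    h.one_div_mul_eq h.constraint_v₃_eq', dualBianchi₄]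
  simp (disch := fun_prop) only [constraint_u₇, constraint_u₈, constraint_u₉, frameDeriv_add,
    frameDeriv_sub, frameDeriv_mul, frameDeriv_neg, frameDeriv_const, h.comm_N_D, h.comm_N_Db,
    frameDeriv_congr h.γ₆_eq, frameDeriv_congr h.γ₇_eq, h.γ₆_eq.eq_of_nhds, h.γ₇_eq.eq_of_nhds]
  ring

theorem dual_t₁ (h : SolvesNear lam Φ x) :
    ∇[3] Φ (fun y => (𝒞 lam Φ y).1 0) x
      = (hatRHS lam Φ x (𝒞 lam Φ x)).1 0 := by
  have := h.fact
  -- The defects of `[L, D]` on ē₁ and of `[L, D̄]` on e₁ are conjugate; together they form the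
  -- imaginary part of t₃ ∂₃ē₁ on the right.
  have hc : conj (partialDeriv 2 Φ.e₁† x) = partialDeriv 2 Φ.e₁ x := by
    rw [← partialDeriv_conj, conjFun_conjFun]
  simp only [hatRHS_t₁, ofReal_two_mul_im, map_mul, conj_conjFun_apply, hc, h.conj_constraint_u₁]
  simp (disch := fun_prop) only [frameDeriv_congr h.constraint_t₁, h.constraint_t₁.eq_of_nhds,
    constraint_u₁, frameDeriv_add, frameDeriv_sub, frameDeriv_mul, frameDeriv_neg,
    frameDeriv_const, h.comm_L_D, h.comm_L_Db, frameDeriv_congr h.e₁_eq, frameDeriv_congr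
    h.conj_e₁_eq, h.e₁_eq.eq_of_nhds, h.conj_e₁_eq.eq_of_nhds, h.γ₃_eq.eq_of_nhds,
    h.conj_γ₃_eq.eq_of_nhds, h.γ₄_eq.eq_of_nhds, h.conj_γ₄_eq.eq_of_nhds]
  ring

theorem dual_t₂ (h : SolvesNear lam Φ x) :
    ∇[3] Φ (fun y => (𝒞 lam Φ y).1 1) x
      = (hatRHS lam Φ x (𝒞 lam Φ x)).1 1 := by
  have := h.fact
  have hc : conj (partialDeriv 2 Φ.e₂† x) = partialDeriv 2 Φ.e₂ x := by
    rw [← partialDeriv_conj, conjFun_conjFun]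
  simp only [hatRHS_t₂, ofReal_two_mul_im, map_mul, conj_conjFun_apply, hc, h.conj_constraint_u₁]
  simp (disch := fun_prop) only [frameDeriv_congr h.constraint_t₂, h.constraint_t₂.eq_of_nhds,
    constraint_u₁, frameDeriv_add, frameDeriv_sub, frameDeriv_mul, frameDeriv_neg,
    frameDeriv_const, h.comm_L_D, h.comm_L_Db, frameDeriv_congr h.e₂_eq, frameDeriv_congr
    h.conj_e₂_eq, h.e₂_eq.eq_of_nhds, h.conj_e₂_eq.eq_of_nhds, h.γ₃_eq.eq_of_nhds,
    h.conj_γ₃_eq.eq_of_nhds, h.γ₄_eq.eq_of_nhds, h.conj_γ₄_eq.eq_of_nhds]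
  ring

/-- (SHS) prescribes neither N(γ₃) nor N(γ₄). They occur in the combination with D(γ₈) and its
counterpart for the conjugate of γ₈ that u₇ and the conjugate of u₈ supply. -/
theorem dual_t₃ (h : SolvesNear lam Φ x) :
    ∇[2] Φ (fun y => (𝒞 lam Φ y).1 2) x
      = (hatRHS lam Φ x (𝒞 lam Φ x)).1 2 := by
  have := h.fact
  simp only [hatRHS_t₃, h.conj_constraint_u₈, h.conj_constraint_t₃]
  simp (disch := fun_prop) only [constraint_t₃, constraint_u₇, frameDeriv_add, frameDeriv_sub,
    frameDeriv_mul, h.comm_N_D, frameDeriv_congr h.e₃_eq, h.e₃_eq.eq_of_nhds,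
    h.conj_γ₅_eq.eq_of_nhds]
  ring

theorem dual_t₄ (h : SolvesNear lam Φ x) :
    ∇[3] Φ (fun y => (𝒞 lam Φ y).1 3) x
      = (hatRHS lam Φ x (𝒞 lam Φ x)).1 3 := by
  have := h.fact
  simp only [hatRHS_t₄, h.conj_constraint_u₄, h.conj_constraint_u₆, h.conj_constraint_t₄]
  simp (disch := fun_prop) only [constraint_t₄, h.constraint_t₁.eq_of_nhds, constraint_u₃,
    constraint_u₅, frameDeriv_add, frameDeriv_sub, frameDeriv_mul, frameDeriv_neg, h.comm_L_Db,
    h.comm_L_N, frameDeriv_congr h.conj_e₁_eq, frameDeriv_congr h.e₄_eq, h.e₁_eq.eq_of_nhds,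
    h.conj_e₁_eq.eq_of_nhds, h.e₄_eq.eq_of_nhds, h.γ₈_eq.eq_of_nhds, h.conj_γ₈_eq.eq_of_nhds]
  -- The factor i in front of t₁ meets the i in t₁ = i(z − z̄), so i² = −1 has to be supplied to the
  -- ring identity.
  linear_combination -(Φ.γ₃† x - Φ.γ₄ x + Φ.γ₅ x) * (∇[0] Φ Φ.e₁† x +
    Φ.e₁† x * Φ.γ₃ x + Φ.e₁† x * Φ.γ₄† x - (∇[1] Φ Φ.e₁ x + Φ.e₁ x *
    Φ.γ₃† x + Φ.e₁ x * Φ.γ₄ x)) * Complex.I_mul_I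

theorem dual_t₅ (h : SolvesNear lam Φ x) :
    ∇[3] Φ (fun y => (𝒞 lam Φ y).1 4) x
      = (hatRHS lam Φ x (𝒞 lam Φ x)).1 4 := by
  have := h.fact
  simp only [hatRHS_t₅, h.conj_constraint_u₄, h.conj_constraint_u₆, h.conj_constraint_t₅]
  simp (disch := fun_prop) only [constraint_t₅, h.constraint_t₂.eq_of_nhds, constraint_u₃,
    constraint_u₅, frameDeriv_add, frameDeriv_sub, frameDeriv_mul, frameDeriv_neg, h.comm_L_Db,
    h.comm_L_N, frameDeriv_congr h.conj_e₂_eq, frameDeriv_congr h.e₅_eq, h.e₂_eq.eq_of_nhds,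
    h.conj_e₂_eq.eq_of_nhds, h.e₅_eq.eq_of_nhds, h.γ₈_eq.eq_of_nhds, h.conj_γ₈_eq.eq_of_nhds]
  linear_combination -(Φ.γ₃† x - Φ.γ₄ x + Φ.γ₅ x) * (∇[0] Φ Φ.e₂† x +
    Φ.e₂† x * Φ.γ₃ x + Φ.e₂† x * Φ.γ₄† x - (∇[1] Φ Φ.e₂ x + Φ.e₂ x *
    Φ.γ₃† x + Φ.e₂ x * Φ.γ₄ x)) * Complex.I_mul_I

/-- The second derivatives of w₂ and w₃ are commutators `[N, L]` and `[D, L]`. The remaining ones, N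
D̄ w₁ + D D̄ w₂, commute to D̄(N w₁ + D w₂), which the first row of the w-system reduces to first
order. Commutator defects give the t terms, derivatives of γ the u terms. -/
theorem dual_bianchi₁ (h : SolvesNear lam Φ x) :
    ∇[2] Φ (bianchi₁ Φ) x - ∇[3] Φ (dualBianchi₂ Φ) x + ∇[0] Φ (bianchi₂
        Φ) x
      = -I * (𝒞 lam Φ x).1 0 * partialDeriv 0 Φ.w₂ x - I *
          (constraintField
        lam Φ x).1 1 * partialDeriv 1 Φ.w₂ x + (𝒞 lam Φ x).1 2 * partialDeriv 2 Φ.w₃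
        x - (𝒞 lam Φ x).1 3 * partialDeriv 0 Φ.w₁ x - (𝒞 lam Φ x).1 4
        * partialDeriv 1 Φ.w₁ x + 3 * Φ.w₃ x * (𝒞 lam Φ x).2.1 0 + 2 * Φ.w₂ x *
        (𝒞 lam Φ x).2.1 1 + 4 * Φ.w₂ x * (𝒞 lam Φ x).2.1 2 - 2 * Φ.w₂
        x * (𝒞 lam Φ x).2.1 5 + 4 * Φ.w₁ x * (𝒞 lam Φ x).2.1 7 + Φ.w₁
        x * (𝒞 lam Φ x).2.1 8 + (4 * Φ.γ₂ x) * dualBianchi₂ Φ x + (-2 * Φ.γ₆ x + 3 *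
        Φ.γ₈ x + Φ.γ₈† x) * bianchi₁ Φ x + (4 * Φ.γ₃ x - 4 * Φ.γ₄† x - Φ.γ₅†
        x) * bianchi₂ Φ x + (-2 * Φ.γ₁ x) * bianchi₃ Φ x := by
  have := h.fact
  unfold bianchi₁ bianchi₂ bianchi₃ dualBianchi₂
  simp (disch := fun_prop) only [constraint_u₁, constraint_u₂, constraint_u₃, constraint_u₆,
    constraint_u₈, constraint_u₉, frameDeriv_add, frameDeriv_sub, frameDeriv_mul, frameDeriv_neg,
    frameDeriv_const, h.comm_N_Db, h.comm_N_L, h.comm_L_D, h.comm_D_Db, frameDeriv_congr h.w₁_eq,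
    h.γ₁_eq.eq_of_nhds, h.γ₃_eq.eq_of_nhds, h.conj_γ₄_eq.eq_of_nhds, h.γ₅_eq.eq_of_nhds,
    h.γ₈_eq.eq_of_nhds, h.w₁_eq.eq_of_nhds]
  ring

/-- v₁ is read as λ₁b₁ under `N` and as −λ₂d₂ under `L`, and v₂ as λ₂b₂ under `D`, so the weights
drop out of the principal part and `dual_bianchi₁` applies. The same relations convert b and d back
into v. -/
theorem dual_v₁ (h : SolvesNear lam Φ x) :
    1 / (lam 0 x : ℂ) * ∇[2] Φ (fun y => (𝒞 lam Φ y).2.2 0) x + 1 / (lam 1 x :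
      ℂ) * ∇[3] Φ (fun y => (𝒞 lam Φ y).2.2 0) x + 1 / (lam 1 x : ℂ) *
      ∇[0] Φ (fun y => (𝒞 lam Φ y).2.2 1) x
      = (hatRHS lam Φ x (𝒞 lam Φ x)).2.2 0 := by
  have := h.fact
  have hb₁ : DifferentiableAt ℝ (bianchi₁ Φ) x := by
    unfold bianchi₁
    fun_prop
  have hd₂ : DifferentiableAt ℝ (dualBianchi₂ Φ) x := by
    unfold dualBianchi₂
    fun_prop
  have hb₂ : DifferentiableAt ℝ (bianchi₂ Φ) x := by
    unfold bianchi₂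
    fun_prop
  rw [hatRHS_v₁, h.one_div_mul_frameDeriv (constraint_v₁_eq lam Φ x) hb₁, h.one_div_mul_frameDeriv
    h.constraint_v₁_eq' hd₂.fun_neg, h.one_div_mul_frameDeriv (constraint_v₂_eq lam Φ x) hb₂,
    frameDeriv_neg]
  linear_combination h.dual_bianchi₁ + (4 * Φ.γ₂ x) * h.one_div_mul_eq h.constraint_v₁_eq' - (-2 *
    Φ.γ₆ x + 3 * Φ.γ₈ x + Φ.γ₈† x) * h.one_div_mul_eq (constraint_v₁_eq lam Φ x) - (4 *
    Φ.γ₃ x - 4 * Φ.γ₄† x - Φ.γ₅† x) * h.one_div_mul_eq (constraint_v₂_eq lam Φ x) -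
    (-2 * Φ.γ₁ x) * h.one_div_mul_eq (constraint_v₃_eq lam Φ x)

/-- In the middle row all second derivatives already pair into commutators. The first and last rows
of the w-system are used only for N(w₁) and L(w₅), which come from the lower order terms γ₇w₁ and
γ₁w₅. -/
theorem dual_bianchi₂ (h : SolvesNear lam Φ x) :
    -∇[1] Φ (dualBianchi₂ Φ) x + ∇[2] Φ (bianchi₂ Φ) x - ∇[3] Φ
        (dualBianchi₃
      Φ) x + ∇[0] Φ (bianchi₃ Φ) x
      = -I * (𝒞 lam Φ x).1 0 * partialDeriv 0 Φ.w₃ x - I *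
          (constraintField
        lam Φ x).1 1 * partialDeriv 1 Φ.w₃ x + (𝒞 lam Φ x).1 2 * partialDeriv 2 Φ.w₄
        x - (𝒞 lam Φ x).1 3 * partialDeriv 0 Φ.w₂ x - (𝒞 lam Φ x).1 4
        * partialDeriv 1 Φ.w₂ x + 2 * Φ.w₄ x * (𝒞 lam Φ x).2.1 0 + 3 * Φ.w₃ x *
        (𝒞 lam Φ x).2.1 2 - 3 * Φ.w₃ x * (𝒞 lam Φ x).2.1 5 + 2 * Φ.w₂
        x * (𝒞 lam Φ x).2.1 7 + 2 * Φ.w₂ x * (𝒞 lam Φ x).2.1 8 + (2 *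
        Φ.γ₄ x + 2 * Φ.γ₅ x) * dualBianchi₂ Φ x + (3 * Φ.γ₂ x) * dualBianchi₃ Φ x + (-3 * Φ.γ₆ x +
        Φ.γ₈ x + Φ.γ₈† x) * bianchi₂ Φ x + (Φ.γ₃ x - 3 * Φ.γ₄† x - Φ.γ₅† x) *
        bianchi₃ Φ x := by
  have := h.fact
  unfold bianchi₂ bianchi₃ dualBianchi₂ dualBianchi₃
  simp (disch := fun_prop) only [constraint_u₁, constraint_u₃, constraint_u₆, constraint_u₈,
    constraint_u₉, frameDeriv_add, frameDeriv_sub, frameDeriv_mul, frameDeriv_const, h.comm_N_Db,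
    h.comm_N_L, h.comm_L_D, h.comm_D_Db, h.γ₁_eq.eq_of_nhds, h.conj_γ₄_eq.eq_of_nhds,
    h.γ₅_eq.eq_of_nhds, h.γ₇_eq.eq_of_nhds, h.w₁_eq.eq_of_nhds, h.w₅_eq.eq_of_nhds]
  ring

theorem dual_v₂ (h : SolvesNear lam Φ x) :
    1 / (lam 1 x : ℂ) * ∇[1] Φ (fun y => (𝒞 lam Φ y).2.2 0) x + 1 / (lam 1 x :
      ℂ) * ∇[2] Φ (fun y => (𝒞 lam Φ y).2.2 1) x + 1 / (lam 2 x : ℂ) *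
      ∇[3] Φ (fun y => (𝒞 lam Φ y).2.2 1) x + 1 / (lam 2 x : ℂ) * ∇[0] Φ (fun y => (𝒞 lam Φ y).2.2
          2) x
      = (hatRHS lam Φ x (𝒞 lam Φ x)).2.2 1 := by
  have := h.fact
  have hd₂ : DifferentiableAt ℝ (dualBianchi₂ Φ) x := by
    unfold dualBianchi₂
    fun_prop
  have hb₂ : DifferentiableAt ℝ (bianchi₂ Φ) x := by
    unfold bianchi₂
    fun_prop
  have hd₃ : DifferentiableAt ℝ (dualBianchi₃ Φ) x := by
    unfold dualBianchi₃
    fun_prop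
  have hb₃ : DifferentiableAt ℝ (bianchi₃ Φ) x := by
    unfold bianchi₃
    fun_prop
  rw [hatRHS_v₂, h.one_div_mul_frameDeriv h.constraint_v₁_eq' hd₂.fun_neg, h.one_div_mul_frameDeriv
    (constraint_v₂_eq lam Φ x) hb₂, h.one_div_mul_frameDeriv h.constraint_v₂_eq' hd₃.fun_neg,
    h.one_div_mul_frameDeriv (constraint_v₃_eq lam Φ x) hb₃, frameDeriv_neg, frameDeriv_neg]
  linear_combination h.dual_bianchi₂ + (2 * Φ.γ₄ x + 2 * Φ.γ₅ x) * h.one_div_mul_eq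
    h.constraint_v₁_eq' + (3 * Φ.γ₂ x) * h.one_div_mul_eq h.constraint_v₂_eq' - (-3 * Φ.γ₆ x +
    Φ.γ₈ x + Φ.γ₈† x) * h.one_div_mul_eq (constraint_v₂_eq lam Φ x) - (Φ.γ₃ x - 3 * Φ.γ₄† x -
        Φ.γ₅† x) * h.one_div_mul_eq (constraint_v₃_eq lam Φ x)

/-- The mirror image of `dual_bianchi₁`: the second derivatives −D̄ D w₄ − L D w₅ are left unpaired,
and the last row of the w-system, differentiated by `D`, turns them into `[D, D̄]` on w₄ up to first
order. -/
theorem dual_bianchi₃ (h : SolvesNear lam Φ x) :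
    -∇[1] Φ (dualBianchi₃ Φ) x + ∇[2] Φ (bianchi₃ Φ) x - ∇[3] Φ
        (dualBianchi₄
      Φ) x
      = -I * (𝒞 lam Φ x).1 0 * partialDeriv 0 Φ.w₄ x - I *
          (constraintField
        lam Φ x).1 1 * partialDeriv 1 Φ.w₄ x + (𝒞 lam Φ x).1 2 * partialDeriv 2 Φ.w₅
        x - (𝒞 lam Φ x).1 3 * partialDeriv 0 Φ.w₃ x - (𝒞 lam Φ x).1 4
        * partialDeriv 1 Φ.w₃ x + Φ.w₅ x * (𝒞 lam Φ x).2.1 0 - 2 * Φ.w₄ x *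
        (𝒞 lam Φ x).2.1 1 + 2 * Φ.w₄ x * (𝒞 lam Φ x).2.1 2 - 4 * Φ.w₄
        x * (𝒞 lam Φ x).2.1 5 + 3 * Φ.w₃ x * (𝒞 lam Φ x).2.1 8 + (2 *
        Φ.γ₇ x) * dualBianchi₂ Φ x + (3 * Φ.γ₅ x) * dualBianchi₃ Φ x + (2 * Φ.γ₂ x) * dualBianchi₄
        Φ x + (-4 * Φ.γ₆ x - Φ.γ₈ x + Φ.γ₈† x) * bianchi₃ Φ x := by
  have := h.fact
  unfold bianchi₃ dualBianchi₂ dualBianchi₃ dualBianchi₄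
  simp (disch := fun_prop) only [constraint_u₁, constraint_u₂, constraint_u₃, constraint_u₆,
    constraint_u₉, frameDeriv_add, frameDeriv_sub, frameDeriv_mul, frameDeriv_neg,
    frameDeriv_const, h.comm_N_Db, h.comm_N_L, h.comm_L_D, h.comm_D_Db, frameDeriv_congr h.w₅_eq,
    h.γ₃_eq.eq_of_nhds, h.conj_γ₄_eq.eq_of_nhds, h.γ₅_eq.eq_of_nhds, h.γ₇_eq.eq_of_nhds,
    h.γ₈_eq.eq_of_nhds, h.w₅_eq.eq_of_nhds]
  ring

theorem dual_v₃ (h : SolvesNear lam Φ x) :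
    1 / (lam 2 x : ℂ) * ∇[1] Φ (fun y => (𝒞 lam Φ y).2.2 1) x + 1 / (lam 2 x :
      ℂ) * ∇[2] Φ (fun y => (𝒞 lam Φ y).2.2 2) x + 1 / (lam 3 x : ℂ) *
      ∇[3] Φ (fun y => (𝒞 lam Φ y).2.2 2) x
      = (hatRHS lam Φ x (𝒞 lam Φ x)).2.2 2 := by
  have := h.fact
  have hd₃ : DifferentiableAt ℝ (dualBianchi₃ Φ) x := by
    unfold dualBianchi₃
    fun_prop
  have hb₃ : DifferentiableAt ℝ (bianchi₃ Φ) x := by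
    unfold bianchi₃
    fun_prop
  have hd₄ : DifferentiableAt ℝ (dualBianchi₄ Φ) x := by
    unfold dualBianchi₄
    fun_prop
  rw [hatRHS_v₃, h.one_div_mul_frameDeriv h.constraint_v₂_eq' hd₃.fun_neg, h.one_div_mul_frameDeriv
    (constraint_v₃_eq lam Φ x) hb₃, h.one_div_mul_frameDeriv h.constraint_v₃_eq' hd₄.fun_neg,
    frameDeriv_neg, frameDeriv_neg]
  linear_combination h.dual_bianchi₃ + (2 * Φ.γ₇ x) * h.one_div_mul_eq h.constraint_v₁_eq' + (3 *
    Φ.γ₅ x) * h.one_div_mul_eq h.constraint_v₂_eq' + (2 * Φ.γ₂ x) * h.one_div_mul_eq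
    h.constraint_v₃_eq' - (-4 * Φ.γ₆ x - Φ.γ₈ x + Φ.γ₈† x) * h.one_div_mul_eq
    (constraint_v₃_eq lam Φ x)

end DualSystem.SolvesNear

namespace DualSystem

/-! ### Symmetric hyperbolicity of the dual system -/

theorem conj_frame_two {p : StateVec} (hp : p ∈ stateSpace) (μ : Fin 4) :
    conj (frame p 2 μ) = frame p 2 μ := frame_conj hp

theorem conj_frame_three {p : StateVec} (hp : p ∈ stateSpace) (μ : Fin 4) :
    conj (frame p 3 μ) = frame p 3 μ := frame_conj hp

theorem conj_frame_zero {p : StateVec} (hp : p ∈ stateSpace) (μ : Fin 4) :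
    conj (frame p 0 μ) = frame p 1 μ := frame_conj hp

theorem conj_frame_one {p : StateVec} (hp : p ∈ stateSpace) (μ : Fin 4) :
    conj (frame p 1 μ) = frame p 0 μ := frame_conj hp

/-- Real frame fields on the diagonal give Hermitian coefficients. In the sum of the ∂₃ and ∂₄
coefficients an entry `N` becomes 1 and an entry `L` becomes e₃. -/
theorem isSymmetricHyperbolic_diagonal {n : Type} [Fintype n] [DecidableEq n] {p : StateVec}
    (hp : p ∈ stateSpace) (h3 : 0 < (p.1 2).re) {d : Fin 4 → n → ℂ}
    (hd : ∀ i, (∀ μ, d μ i = frame p 2 μ) ∨ ∀ μ, d μ i = frame p 3 μ) :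
    IsSymmetricHyperbolic fun μ => Matrix.diagonal (d μ) := by
  refine ⟨fun μ => Matrix.isHermitian_diagonal_of_self_adjoint _ ?_, ?_⟩
  · ext i
    obtain h | h := hd i
    · simp [h, conj_frame_two hp]
    · simp [h, conj_frame_three hp]
  · rw [Matrix.diagonal_add, Matrix.posDef_diagonal_iff]
    intro i
    obtain h | h := hd i
    · simp [h, frame]
    · simpa [h, frame] using Complex.pos_iff.2 ⟨h3, hp.1.symm⟩

theorem isSymmetricHyperbolic_coeffHat₁ {p : StateVec} (hp : p ∈ stateSpace)
    (h3 : 0 < (p.1 2).re) : IsSymmetricHyperbolic (coeffHat₁ p) :=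
  isSymmetricHyperbolic_diagonal hp h3 fun i => by fin_cases i <;> simp

theorem isSymmetricHyperbolic_coeffHat₂ {p : StateVec} (hp : p ∈ stateSpace)
    (h3 : 0 < (p.1 2).re) : IsSymmetricHyperbolic (coeffHat₂ p) :=
  isSymmetricHyperbolic_diagonal hp h3 fun i => by fin_cases i <;> simp

theorem isSymmetricHyperbolic_coeffHat₃ {l : Fin 4 → ℝ} (hl : ∀ i, 0 < l i) {p : StateVec}
    (hp : p ∈ stateSpace) (h3 : 0 < (p.1 2).re) : IsSymmetricHyperbolic (coeffHat₃ l p) := by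
  constructor
  · intro μ
    ext i j
    fin_cases i <;> fin_cases j <;>
      simp [coeffHat₃, conj_frame_zero hp, conj_frame_one hp, conj_frame_two hp,
        conj_frame_three hp]
  -- `D` and `D̄` have no ∂₃ or ∂₄ component, so the off-diagonal entries vanish in this sum.
  · have h : coeffHat₃ l p 2 + coeffHat₃ l p 3 = Matrix.diagonal
        ![1 / (l 0 : ℂ) + 1 / (l 1 : ℂ) * p.1 2, 1 / (l 1 : ℂ) + 1 / (l 2 : ℂ) * p.1 2,
          1 / (l 2 : ℂ) + 1 / (l 3 : ℂ) * p.1 2] := by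
      ext i j
      fin_cases i <;> fin_cases j <;> simp [coeffHat₃, frame, add_comm]
    have he : (0 : ℂ) < p.1 2 := Complex.pos_iff.2 ⟨h3, hp.1.symm⟩
    have hc : ∀ i, (0 : ℂ) < 1 / (l i : ℂ) := fun i => by
      have := one_div_pos.2 (hl i)
      exact_mod_cast this
    rw [h, Matrix.posDef_diagonal_iff]
    intro i
    fin_cases i <;> exact add_pos (hc _) (mul_pos (hc _) he)

/-! ### Linearity of the right hand side -/

/-- Linearity is only over ℝ because conjugates and imaginary parts of ψ occur; both are additive
and commute with real scalars. -/
theorem isLinearMap_hatRHS (lam : Fin 4 → Point → ℝ) (Φ : StateField) (x : Point) :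
    IsLinearMap ℝ (hatRHS lam Φ x) := by
  constructor
  · intro ψ φ
    ext i <;> fin_cases i <;>
      simp only [Fin.zero_eta, Fin.mk_one, Fin.reduceFinMk, Prod.fst_add, Prod.snd_add,
        Pi.add_apply, hatRHS_t₁, hatRHS_t₂, hatRHS_t₃,
        hatRHS_t₄, hatRHS_t₅, hatRHS_u₁, hatRHS_u₂, hatRHS_u₃, hatRHS_u₄, hatRHS_u₅, hatRHS_u₆,
        hatRHS_u₇, hatRHS_u₈, hatRHS_u₉, hatRHS_v₁, hatRHS_v₂, hatRHS_v₃, ofReal_two_mul_im,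
        map_add, map_mul] <;>
      ring
  · intro c ψ
    ext i <;> fin_cases i <;>
      simp only [Fin.zero_eta, Fin.mk_one, Fin.reduceFinMk, Prod.smul_fst, Prod.smul_snd,
        Pi.smul_apply, Complex.real_smul, hatRHS_t₁, hatRHS_t₂, hatRHS_t₃,
        hatRHS_t₄, hatRHS_t₅, hatRHS_u₁, hatRHS_u₂, hatRHS_u₃, hatRHS_u₄, hatRHS_u₅, hatRHS_u₆,
        hatRHS_u₇, hatRHS_u₈, hatRHS_u₉, hatRHS_v₁, hatRHS_v₂, hatRHS_v₃, ofReal_two_mul_im,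
        map_mul, Complex.conj_ofReal] <;>
      ring

/-- Only the first two rows matter: γ₂, t₁ and t₂ are real, and the remaining terms are imaginary
parts. -/
theorem hatRHS_mem {lam : Fin 4 → Point → ℝ} {Φ : StateField} {x : Point}
    (hΦ : Φ x ∈ stateSpace) {ψ : ConstraintVec} (hψ : ψ ∈ constraintSpace) :
    hatRHS lam Φ x ψ ∈ constraintSpace := by
  have hγ : (Φ.γ₂ x).im = 0 := hΦ.2.2.2.1
  obtain ⟨h1, h2⟩ := hψ
  constructor
  · rw [hatRHS_t₁]
    simp [hγ, h1]
  · rw [hatRHS_t₂]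
    simp [hγ, h2]

/-! ### The constraint field solves the dual system -/

namespace SolvesNear

variable {lam : Fin 4 → Point → ℝ} {Φ : StateField} {x : Point}

theorem contDiffAt_constraintField (h : SolvesNear lam Φ x) :
    ContDiffAt ℝ 1 (𝒞 lam Φ) x := by
  have := h.fact
  have hw := h.contDiffAt_weightC
  have ht (i) : ContDiffAt ℝ 1 (fun y => (𝒞 lam Φ y).1 i) x := by
    fin_cases i
    · exact ContDiffAt.congr_of_eventuallyEq (by fun_prop) h.constraint_t₁
    · exact ContDiffAt.congr_of_eventuallyEq (by fun_prop) h.constraint_t₂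
    all_goals
      simp only [Fin.reduceFinMk, constraint_t₃, constraint_t₄, constraint_t₅]
      fun_prop
  have hu (i) : ContDiffAt ℝ 1 (fun y => (𝒞 lam Φ y).2.1 i) x := by
    fin_cases i <;>
      simp only [Fin.zero_eta, Fin.mk_one, Fin.reduceFinMk, constraint_u₁, constraint_u₂,
        constraint_u₃, constraint_u₄, constraint_u₅, constraint_u₆, constraint_u₇, constraint_u₈,
        constraint_u₉] <;>
      fun_prop
  have hv (i) : ContDiffAt ℝ 1 (fun y => (𝒞 lam Φ y).2.2 i) x := by
    fin_cases i <;>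
      simp only [Fin.zero_eta, Fin.mk_one, Fin.reduceFinMk, constraint_v₁, constraint_v₂,
        constraint_v₃] <;>
      fun_prop
  exact (contDiffAt_pi.2 ht).prodMk ((contDiffAt_pi.2 hu).prodMk (contDiffAt_pi.2 hv))

theorem hatLHS_constraintField (h : SolvesNear lam Φ x) :
    hatLHS lam Φ (𝒞 lam Φ) x = hatRHS lam Φ x (𝒞 lam Φ x) := by
  refine Prod.ext (funext fun i => ?_) (Prod.ext (funext fun i => ?_) (funext fun i => ?_))
  · refine (matrixOp_coeffHat₁ Φ (fun y => (𝒞 lam Φ y).1) x i).trans ?_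
    fin_cases i
    exacts [h.dual_t₁, h.dual_t₂, h.dual_t₃, h.dual_t₄, h.dual_t₅]
  · refine (matrixOp_coeffHat₂ Φ (fun y => (𝒞 lam Φ y).2.1) x i).trans ?_
    fin_cases i
    exacts [h.dual_u₁, h.dual_u₂, h.dual_u₃, h.dual_u₄, h.dual_u₅, h.dual_u₆, h.dual_u₇,
      h.dual_u₈, h.dual_u₉]
  · refine (congrFun (matrixOp_coeffHat₃ (fun i => lam i x) Φ
      (fun y => (𝒞 lam Φ y).2.2) x) i).trans ?_
    fin_cases i
    exacts [h.dual_v₁, h.dual_v₂, h.dual_v₃]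

end SolvesNear

theorem constraintField_mem (lam : Fin 4 → Point → ℝ) (Φ : StateField) (x : Point) :
    𝒞 lam Φ x ∈ constraintSpace :=
  ⟨by simp [constraintField], by simp [constraintField]⟩

theorem isDualSolution_zero (U : Set Point) (lam : Fin 4 → Point → ℝ) (Φ : StateField) :
    IsDualSolution U lam Φ 0 where
  contDiffOn := contDiffOn_const
  mem_constraintSpace _ _ := constraintSpace.zero_mem
  equation x _ := by
    have hp : ∀ μ, partialDeriv μ (fun _ => 0) x = 0 := by simp [partialDeriv]
    rw [Pi.zero_apply, (isLinearMap_hatRHS lam Φ x).map_zero]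
    simp only [hatLHS, matrixOp, Pi.zero_apply, Prod.fst_zero, Prod.snd_zero, hp]
    ext i <;> simp [Matrix.mulVec, dotProduct]

end DualSystem

/-! ### Assembly of the proposition -/

theorem mainTheorem7 (U : Set DualSystem.Point) (hU : IsOpen U)
    (lam : Fin 4 → DualSystem.Point → ℝ)
    (hlam_pos : ∀ i, ∀ x ∈ U, 0 < lam i x)
    (hlam : ∀ i, ContDiffOn ℝ 1 (lam i) U)
    (Φ : DualSystem.StateField)
    (hΦ_range : ∀ x ∈ U, Φ x ∈ DualSystem.stateSpace)
    (hΦ_star : ∀ x ∈ U, 0 < (Φ.e₃ x).re)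
    (hΦ : ContDiffOn ℝ 2 Φ U)
    (hSHS : DualSystem.SolvesSHS U lam Φ) :
    -- the constraint field is a classical solution of the dual system
    DualSystem.IsDualSolution U lam Φ (DualSystem.constraintField lam Φ) ∧
    -- the dual system is homogeneous, linear over the reals, and symmetric hyperbolic
    (∀ x ∈ U, IsLinearMap ℝ (DualSystem.hatRHS lam Φ x) ∧
      (∀ ψ ∈ DualSystem.constraintSpace,
        DualSystem.hatRHS lam Φ x ψ ∈ DualSystem.constraintSpace) ∧
      DualSystem.IsSymmetricHyperbolic (DualSystem.coeffHat₁ (Φ x)) ∧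
      DualSystem.IsSymmetricHyperbolic (DualSystem.coeffHat₂ (Φ x)) ∧
      DualSystem.IsSymmetricHyperbolic (DualSystem.coeffHat₃ (fun i => lam i x) (Φ x))) ∧
    -- in every well-posed problem, vanishing data force the constraint field to vanish
    (∀ (X : Type*) [AddCommGroup X] [Module ℝ X] (P : DualSystem.DataProblem U X),
      P.HasUniqueness lam Φ →
      ∀ h : U.domRestrict (DualSystem.constraintField lam Φ) ∈ P.admissible,
        P.data ⟨U.domRestrict (DualSystem.constraintField lam Φ), h⟩ = 0 →
        ∀ x ∈ U, DualSystem.constraintField lam Φ x = 0) := by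
  -- Since `U` is open, the equations hold on a neighbourhood of each of its points, so they can be
  -- differentiated there.
  have hN : ∀ x ∈ U, DualSystem.SolvesNear lam Φ x := fun x hx =>
    have hev := hU.mem_nhds hx
    { lam_pos := Filter.eventually_all.2 fun i => Filter.mem_of_superset hev (hlam_pos i)
      contDiffAt_lam := fun i => (hlam i).contDiffAt hev
      contDiffAt := hΦ.contDiffAt hev
      mem_stateSpace := Filter.mem_of_superset hev hΦ_range
      equation := Filter.mem_of_superset hev hSHS }
  have hsol : DualSystem.IsDualSolution U lam Φ (DualSystem.constraintField lam Φ) :=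
    { contDiffOn := fun x hx => (hN x hx).contDiffAt_constraintField.contDiffWithinAt
      mem_constraintSpace := fun x _ => DualSystem.constraintField_mem lam Φ x
      equation := fun x hx => (hN x hx).hatLHS_constraintField }
  refine ⟨hsol, fun x hx => ⟨DualSystem.isLinearMap_hatRHS lam Φ x,
    fun ψ hψ => DualSystem.hatRHS_mem (hΦ_range x hx) hψ,
    DualSystem.isSymmetricHyperbolic_coeffHat₁ (hΦ_range x hx) (hΦ_star x hx),
    DualSystem.isSymmetricHyperbolic_coeffHat₂ (hΦ_range x hx) (hΦ_star x hx),
    DualSystem.isSymmetricHyperbolic_coeffHat₃ (fun i => hlam_pos i x hx) (hΦ_range x hx)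
      (hΦ_star x hx)⟩, fun X _ _ P hP h h0 x hx => ?_⟩
  -- By homogeneity the zero field is a solution, and by linearity it is admissible with zero data;
  -- uniqueness identifies the constraint field with it.
  exact hP _ 0 h P.admissible.zero_mem hsol (DualSystem.isDualSolution_zero U lam Φ)
    (h0.trans (map_zero P.data).symm) hx
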